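/- Let $p$ be an odd prime. Let $$Q=\begin{pmatrix}0&1\\1&0\end{pmatrix},\qquad J=\begin{pmatrix}0&-Q\\Q&0\end{pmatrix},\qquad \mathrm{Sp}_4(\mathbb Z)=\{A\in \mathrm{SL}_4(\mathbb Z) : A^TJA=J\},$$ let $\Gamma(p)\subset \mathrm{Sp}_4(\mathbb Z)$ and $\Gamma_2(p)\subset \mathrm{SL}_2(\mathbb Z)$ be the kernels of reduction modulo $p$, let $G_1\subset \mathrm{Sp}_4(\mathbb Z)$ be the subgroup of the matrices whose lower left $2\times 2$ block is zero, and let $V\subset G_1\cap\Gamma(p)$ be the normal subgroup of the elements of the form $\begin{pmatrix}I&B\\0&I\end{pmatrix}$. Let $$T:\mathrm{SL}_2(\mathbb Z)\to \mathrm{SL}_3(\mathbb Z),\qquad \begin{pmatrix}a&b\\c&d\end{pmatrix}\mapsto\begin{pmatrix}a^2&2ab&b^2\\ac&ad+bc&bd\\c^2&2cd&d^2\end{pmatrix}$$ be the symmetric square representation. **Theorem 6.1.** (a) There is an isomorphism of groups $\mathbb Z^3\rtimes_T\Gamma_2(p)\cong G_1\cap \Gamma(p)$, where $\Gamma_2(p)$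 acts on the column vectors $\mathbb Z^3$ through $T$. It maps $\mathbb Z^3$ onto $V$ by $$(x,y,z)\mapsto \begin{pmatrix}I&p\begin{pmatrix}x&y\\y&z\end{pmatrix}Q\\0&I\end{pmatrix},$$ and its restriction to $\Gamma_2(p)$ is $X\mapsto \begin{pmatrix}X&0\\0&Q(X^T)^{-1}Q\end{pmatrix}$. (b) Let $\Gamma_2(p)$ act on $V$ by conjugation in $G_1\cap\Gamma(p)$ through the embedding in (a), and on $H^q(V,\mathbb Z)$ by the induced action, in which $X$ acts as $(c_{X^{-1}})^*$, where $c_X$ denotes conjugation by $X$. Then, as abelian groups, $$H^i(G_1\cap\Gamma(p),\mathbb Z)\cong\begin{cases}\mathbb Z & i=0\\ \mathbb Z^{\,1+\frac{(p-1)p(p+1)}{12}} & i=1\\ H^1(\Gamma_2(p),H^1(V,\mathbb Z)) & i=2\\ \mathbb Z\oplus H^1(\Gamma_2(p),H^2(V,\mathbb Z)) & i=3\\ \mathbb Z^{\,1+\frac{(p-1)p(p+1)}{12}} & i=4\\ 0 & i\ge 5.\end{cases}$$ -/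

import Mathlib

open scoped MatrixGroups

noncomputable section

namespace Siegel

/-! ### Integral cohomology with a group acting on the coefficients or on the group -/

/-- `Hⁿ(G, ℤ)` with trivial coefficients. -/
abbrev HZ (G : Type) [Group G] (n : ℕ) : ModuleCat ℤ :=
  groupCohomology (Rep.trivial ℤ G ℤ) n

/-- The map `α^* : Hⁿ(N, ℤ) → Hⁿ(N', ℤ)` induced by a homomorphism `α : N' → N`. -/
def pullback {N N' : Type} [Group N] [Group N'] (α : N' →* N) (n : ℕ) :
    HZ N n →ₗ[ℤ] HZ N' n :=
  (groupCohomology.map (A := Rep.trivial ℤ N ℤ) (B := Rep.trivial ℤ N' ℤ) α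
    (CategoryTheory.CategoryStruct.id (Rep.trivial ℤ N' ℤ)) n).hom

theorem pullback_id (N : Type) [Group N] (n : ℕ) :
    pullback (MonoidHom.id N) n = LinearMap.id := by
  unfold pullback
  rw [groupCohomology.map_id]
  rfl

theorem pullback_comp {N N' N'' : Type} [Group N] [Group N'] [Group N'']
    (α : N' →* N) (β : N'' →* N') (n : ℕ) :
    pullback (α.comp β) n = pullback β n ∘ₗ pullback α n := by
  unfold pullback
  rw [← ModuleCat.hom_comp]
  congr 1
  exact groupCohomology.map_comp (A := Rep.trivial ℤ N ℤ) (B := Rep.trivial ℤ N' ℤ)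
    (C := Rep.trivial ℤ N'' ℤ) α β (CategoryTheory.CategoryStruct.id _)
    (CategoryTheory.CategoryStruct.id _) n

/-- If `G` acts on a group `N` by automorphisms `φ`, then `G` acts on `Hⁿ(N, ℤ)` on the left,
`g` acting by `(φ g⁻¹)^*`. For the conjugation action this is the usual action in the
Lyndon-Hochschild-Serre spectral sequence. -/
def cohomologyAction {G N : Type} [Group G] [Group N] (φ : G →* MulAut N) (n : ℕ) :
    Representation ℤ G (HZ N n) where
  toFun g := pullback (φ g⁻¹).toMonoidHom n
  map_one' := by
    have h : (φ (1 : G)⁻¹).toMonoidHom = MonoidHom.id N := by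
      ext x; simp
    rw [h, pullback_id]
    rfl
  map_mul' g h := by
    have e : (φ (g * h)⁻¹).toMonoidHom
        = (φ h⁻¹).toMonoidHom.comp (φ g⁻¹).toMonoidHom := by
      ext x; simp
    rw [e, pullback_comp]
    rfl

/-- `Hⁿ(N, ℤ)` as a `ℤ[G]`-module, for a group `G` acting on `N` through `φ`. -/
abbrev cohomologyRep {G N : Type} [Group G] [Group N] (φ : G →* MulAut N) (n : ℕ) : Rep ℤ G :=
  Rep.of (cohomologyAction φ n)

/-! ### The groups -/

/-- The `4 × 4` matrix with `2 × 2` blocks `A B` (top) and `C D` (bottom). -/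
def block (A B C D : Matrix (Fin 2) (Fin 2) ℤ) : Matrix (Fin 4) (Fin 4) ℤ :=
  Matrix.reindex finSumFinEquiv finSumFinEquiv (Matrix.fromBlocks A B C D)

theorem block_mul (A B C D A' B' C' D' : Matrix (Fin 2) (Fin 2) ℤ) :
    block A B C D * block A' B' C' D' =
      block (A * A' + B * C') (A * B' + B * D') (C * A' + D * C') (C * B' + D * D') := by
  simp only [block, Matrix.reindex_apply]
  rw [Matrix.submatrix_mul_equiv, Matrix.fromBlocks_multiply]

theorem block_one : block 1 0 0 1 = 1 := by
  simp [block, Matrix.fromBlocks_one]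

theorem block_transpose (A B C D : Matrix (Fin 2) (Fin 2) ℤ) :
    (block A B C D).transpose = block A.transpose C.transpose B.transpose D.transpose := by
  simp only [block, Matrix.reindex_apply, Matrix.transpose_submatrix,
    Matrix.fromBlocks_transpose]

theorem block_neg (A B C D : Matrix (Fin 2) (Fin 2) ℤ) :
    -(block A B C D) = block (-A) (-B) (-C) (-D) := by
  simp only [block, Matrix.reindex_apply, ← Matrix.fromBlocks_neg]
  rfl

theorem block_injective {A B C D A' B' C' D' : Matrix (Fin 2) (Fin 2) ℤ}
    (h : block A B C D = block A' B' C' D') : A = A' ∧ B = B' ∧ C = C' ∧ D = D' :=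
  Matrix.fromBlocks_inj.1 ((Matrix.reindex finSumFinEquiv finSumFinEquiv).injective h)

/-- The form `J` that defines the symplectic group. -/
def J : Matrix (Fin 4) (Fin 4) ℤ :=
  !![0, 0, 0, -1; 0, 0, -1, 0; 0, 1, 0, 0; 1, 0, 0, 0]

/-- The `2 × 2` permutation matrix `Q`, for which `J = (0, -Q; Q, 0)`. -/
def Q : Matrix (Fin 2) (Fin 2) ℤ := !![0, 1; 1, 0]

theorem J_eq_block : J = block 0 (-Q) Q 0 := by
  decide

theorem Q_mul_Q : Q * Q = 1 := by
  decide

theorem J_mul_J : J * J = -1 := by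
  decide

/-- `Sp₄(ℤ)`: the matrices `A ∈ SL₄(ℤ)` with `Aᵀ J A = J`. -/
def Sp4 : Subgroup SL(4, ℤ) where
  carrier := {A | A.1.transpose * J * A.1 = J}
  one_mem' := by simp
  mul_mem' {A B} hA hB := by
    simp only [Set.mem_ofPred_eq] at hA hB ⊢
    rw [Matrix.SpecialLinearGroup.coe_mul, Matrix.transpose_mul]
    calc B.1.transpose * A.1.transpose * J * (A.1 * B.1)
        = B.1.transpose * (A.1.transpose * J * A.1) * B.1 := by simp only [Matrix.mul_assoc]
      _ = J := by rw [hA, hB]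
  inv_mem' {A} hA := by
    simp only [Set.mem_ofPred_eq] at hA ⊢
    have h1 : A.1 * (A⁻¹).1 = 1 := by
      rw [← Matrix.SpecialLinearGroup.coe_mul, mul_inv_cancel, Matrix.SpecialLinearGroup.coe_one]
    have h2 : (A⁻¹).1.transpose * A.1.transpose = 1 := by
      rw [← Matrix.transpose_mul, h1, Matrix.transpose_one]
    calc (A⁻¹).1.transpose * J * (A⁻¹).1
        = (A⁻¹).1.transpose * (A.1.transpose * J * A.1) * (A⁻¹).1 := by rw [hA]
      _ = ((A⁻¹).1.transpose * A.1.transpose) * J * (A.1 * (A⁻¹).1) := by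
          simp only [Matrix.mul_assoc]
      _ = J := by rw [h1, h2, one_mul, mul_one]

/-- The matrix of an element of `Sp₄(ℤ)`. -/
def mat (g : Sp4) : Matrix (Fin 4) (Fin 4) ℤ := g.1.1

theorem mat_one : mat 1 = 1 := rfl

theorem mat_mul (g h : Sp4) : mat (g * h) = mat g * mat h := rfl

theorem mat_injective : Function.Injective mat := fun _ _ h => Subtype.ext (Subtype.ext h)

theorem mat_inv (g : Sp4) : mat g⁻¹ = -(J * (mat g).transpose * J) := by
  have h1 : mat g * mat g⁻¹ = 1 := by rw [← mat_mul, mul_inv_cancel, mat_one]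
  have h2 : -(J * (mat g).transpose * J) * mat g = 1 := by
    have h3 : (mat g).transpose * J * mat g = J := g.2
    rw [Matrix.neg_mul, Matrix.mul_assoc, Matrix.mul_assoc, ← Matrix.mul_assoc _ J, h3, J_mul_J,
      neg_neg]
  calc mat g⁻¹ = (-(J * (mat g).transpose * J) * mat g) * mat g⁻¹ := by rw [h2, one_mul]
    _ = _ := by rw [Matrix.mul_assoc, h1, mul_one]

/-- The Siegel parabolic `G₁ ⊂ Sp₄(ℤ)`: the matrices whose lower left `2 × 2` block is zero. -/
def G1 : Subgroup Sp4 where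
  carrier := {g | ∃ A B D, mat g = block A B 0 D}
  one_mem' := ⟨1, 0, 1, by rw [mat_one, block_one]⟩
  mul_mem' := by
    rintro g h ⟨A, B, D, hg⟩ ⟨A', B', D', hh⟩
    refine ⟨A * A', A * B' + B * D', D * D', ?_⟩
    rw [mat_mul, hg, hh, block_mul]
    simp
  inv_mem' := by
    rintro g ⟨A, B, D, hg⟩
    refine ⟨Q * D.transpose * Q, -(Q * B.transpose * Q), Q * A.transpose * Q, ?_⟩
    rw [mat_inv, hg, block_transpose, J_eq_block, block_mul, block_mul, block_neg]
    simp

/-- The congruence subgroup `Γ(p) ⊂ Sp₄(ℤ)`: the kernel of reduction modulo `p`. -/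
def Gamma4 (p : ℕ) : Subgroup Sp4 :=
  ((Matrix.SpecialLinearGroup.map (Int.castRingHom (ZMod p))).comp Sp4.subtype).ker

/-- `G₁ ∩ Γ(p)`. -/
abbrev G1Gamma (p : ℕ) : Subgroup Sp4 := G1 ⊓ Gamma4 p

/-- `Γ₂(p) ⊂ SL₂(ℤ)`. -/
abbrev Gamma2 (p : ℕ) : Subgroup SL(2, ℤ) := CongruenceSubgroup.Gamma p

/-- The subgroup `V` of all elements of `G₁ ∩ Γ(p)` of the form `(I, B; 0, I)`. -/
def V (p : ℕ) : Subgroup (G1Gamma p) where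
  carrier := {g | ∃ B, mat g.1 = block 1 B 0 1}
  one_mem' := ⟨0, by rw [block_one]; rfl⟩
  mul_mem' := by
    rintro g h ⟨B, hg⟩ ⟨B', hh⟩
    refine ⟨B' + B, ?_⟩
    rw [Subgroup.coe_mul, mat_mul, hg, hh, block_mul]
    simp
  inv_mem' := by
    rintro g ⟨B, hg⟩
    refine ⟨-(Q * B.transpose * Q), ?_⟩
    rw [Subgroup.coe_inv, mat_inv, hg, block_transpose, J_eq_block, block_mul, block_mul,
      block_neg]
    simp [Q_mul_Q]

instance V_normal (p : ℕ) : (V p).Normal where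
  conj_mem := by
    rintro v ⟨B, hv⟩ g
    obtain ⟨A, C, D, hg⟩ := g.2.1
    obtain ⟨A', C', D', hg'⟩ := (g⁻¹).2.1
    have h1 : mat g.1 * mat (g⁻¹).1 = 1 := by
      rw [← mat_mul, ← Subgroup.coe_mul, mul_inv_cancel]
      rfl
    rw [hg, hg', block_mul, ← block_one] at h1
    obtain ⟨hA, -, -, hD⟩ := block_injective h1
    refine ⟨A * C' + (A * B + C) * D', ?_⟩
    rw [Subgroup.coe_mul, Subgroup.coe_mul, mat_mul, mat_mul, hv, hg, hg', block_mul, block_mul]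
    congr 1
    · simpa using hA
    · simp
    · simp
    · simpa using hD

/-- The element `(X, 0; 0, Q (Xᵀ)⁻¹ Q)` of `SL₄(ℤ)`. -/
def leviSL (X : SL(2, ℤ)) : SL(4, ℤ) :=
  ⟨block X.1 0 0 (Q * (X⁻¹).1.transpose * Q), by
    have hQ : Q.det * Q.det = 1 := by rw [← Matrix.det_mul, Q_mul_Q, Matrix.det_one]
    rw [block, Matrix.det_reindex_self, Matrix.det_fromBlocks_zero₂₁, Matrix.det_mul,
      Matrix.det_mul, Matrix.det_transpose, (X⁻¹).2, X.2]
    linear_combination hQ⟩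

theorem levi_symplectic {X Y : Matrix (Fin 2) (Fin 2) ℤ} (h : Y * X = 1) :
    (block X 0 0 (Q * Y.transpose * Q)).transpose * J * block X 0 0 (Q * Y.transpose * Q) = J := by
  have h' : X.transpose * Y.transpose = 1 := by
    rw [← Matrix.transpose_mul, h, Matrix.transpose_one]
  have hQ : Q.transpose = Q := by decide
  have e1 : X.transpose * Q * (Q * Y.transpose * Q) = Q := by
    calc X.transpose * Q * (Q * Y.transpose * Q)
        = X.transpose * (Q * Q) * Y.transpose * Q := by simp only [Matrix.mul_assoc]
      _ = Q := by rw [Q_mul_Q, mul_one, h', one_mul]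
  have e2 : Q * (Y * Q) * Q * X = Q := by
    calc Q * (Y * Q) * Q * X = Q * (Y * (Q * Q) * X) := by simp only [Matrix.mul_assoc]
      _ = Q := by rw [Q_mul_Q, mul_one, h, mul_one]
  rw [block_transpose, J_eq_block, block_mul, block_mul]
  simp [hQ, e1, e2]

theorem leviSL_mem (X : SL(2, ℤ)) : leviSL X ∈ Sp4 := by
  refine levi_symplectic ?_
  rw [← Matrix.SpecialLinearGroup.coe_mul, inv_mul_cancel, Matrix.SpecialLinearGroup.coe_one]

/-- The homomorphism `X ↦ (X, 0; 0, Q (Xᵀ)⁻¹ Q)` from `SL₂(ℤ)` to `Sp₄(ℤ)`. -/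
def leviHom : SL(2, ℤ) →* Sp4 where
  toFun X := ⟨leviSL X, leviSL_mem X⟩
  map_one' := mat_injective (by
    change block 1 0 0 (Q * ((1 : SL(2, ℤ))⁻¹).1.transpose * Q) = 1
    rw [inv_one, Matrix.SpecialLinearGroup.coe_one, Matrix.transpose_one, mul_one, Q_mul_Q,
      block_one])
  map_mul' X Y := mat_injective (by
    change block (X * Y).1 0 0 (Q * ((X * Y)⁻¹).1.transpose * Q) =
      block X.1 0 0 (Q * (X⁻¹).1.transpose * Q) * block Y.1 0 0 (Q * (Y⁻¹).1.transpose * Q)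
    have e : Q * ((X * Y)⁻¹).1.transpose * Q =
        Q * (X⁻¹).1.transpose * Q * (Q * (Y⁻¹).1.transpose * Q) := by
      calc Q * ((X * Y)⁻¹).1.transpose * Q
          = Q * ((X⁻¹).1.transpose * (Y⁻¹).1.transpose) * Q := by
            rw [mul_inv_rev, Matrix.SpecialLinearGroup.coe_mul, Matrix.transpose_mul]
        _ = Q * (X⁻¹).1.transpose * (Q * Q) * (Y⁻¹).1.transpose * Q := by
            rw [Q_mul_Q, mul_one]; simp only [Matrix.mul_assoc]
        _ = _ := by simp only [Matrix.mul_assoc]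
    rw [block_mul, e, Matrix.SpecialLinearGroup.coe_mul]
    simp)

theorem mat_leviHom (X : SL(2, ℤ)) :
    mat (leviHom X) = block X.1 0 0 (Q * (X⁻¹).1.transpose * Q) := rfl

theorem leviHom_mem {p : ℕ} {X : SL(2, ℤ)} (hX : X ∈ Gamma2 p) : leviHom X ∈ G1Gamma p := by
  refine ⟨⟨_, _, _, mat_leviHom X⟩, ?_⟩
  have hcast : ∀ {Y : SL(2, ℤ)}, Y ∈ Gamma2 p →
      Y.1.map (Int.castRingHom (ZMod p)) = 1 := fun {Y} hY => congrArg Subtype.val hY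
  have h1 := hcast hX
  have h2 := hcast (inv_mem hX)
  refine Subtype.ext ?_
  change (block X.1 0 0 (Q * (X⁻¹).1.transpose * Q)).map (Int.castRingHom (ZMod p)) = 1
  have h3 : (Q * (X⁻¹).1.transpose * Q).map (Int.castRingHom (ZMod p)) = 1 := by
    rw [Matrix.map_mul, Matrix.map_mul, Matrix.transpose_map, h2, Matrix.transpose_one, mul_one,
      ← Matrix.map_mul, Q_mul_Q]
    exact Matrix.map_one _ (map_zero _) (map_one _)
  rw [block, Matrix.reindex_apply, ← Matrix.submatrix_map, Matrix.fromBlocks_map, h1, h3]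
  simp

/-- The splitting `Γ₂(p) → G₁ ∩ Γ(p)`, `X ↦ (X, 0; 0, Q (Xᵀ)⁻¹ Q)`. -/
def levi (p : ℕ) : Gamma2 p →* G1Gamma p :=
  (leviHom.comp (Gamma2 p).subtype).codRestrict (G1Gamma p) fun X => leviHom_mem X.2

/-- The action of `Γ₂(p)` on `V` by conjugation in `G₁ ∩ Γ(p)`. -/
def conjV (p : ℕ) : Gamma2 p →* MulAut (V p) :=
  MulAut.conjNormal.comp (levi p)

/-! ### The symmetric square representation -/

/-- The matrix `T(X)` of the symmetric square of `X = (a, b; c, d)`. -/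
def sym2Matrix (X : Matrix (Fin 2) (Fin 2) ℤ) : Matrix (Fin 3) (Fin 3) ℤ :=
  !![X 0 0 ^ 2, 2 * X 0 0 * X 0 1, X 0 1 ^ 2;
     X 0 0 * X 1 0, X 0 0 * X 1 1 + X 0 1 * X 1 0, X 0 1 * X 1 1;
     X 1 0 ^ 2, 2 * X 1 0 * X 1 1, X 1 1 ^ 2]

/-- The homomorphism `T : SL₂(ℤ) → SL₃(ℤ)`. -/
def sym2 : SL(2, ℤ) →* SL(3, ℤ) where
  toFun X := ⟨sym2Matrix X.1, by
    have h : X.1 0 0 * X.1 1 1 - X.1 0 1 * X.1 1 0 = 1 := by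
      rw [← Matrix.det_fin_two]; exact X.2
    have e : (sym2Matrix X.1).det = (X.1 0 0 * X.1 1 1 - X.1 0 1 * X.1 1 0) ^ 3 := by
      simp [sym2Matrix, Matrix.det_fin_three]
      ring
    rw [e, h, one_pow]⟩
  map_one' := Subtype.ext (by
    change sym2Matrix 1 = 1
    decide)
  map_mul' X Y := Subtype.ext (by
    change sym2Matrix (X.1 * Y.1) = sym2Matrix X.1 * sym2Matrix Y.1
    ext i j
    fin_cases i <;> fin_cases j <;>
      simp [sym2Matrix, Matrix.mul_apply, Fin.sum_univ_succ] <;> ring)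

/-- The group `ℤ³`, written multiplicatively. -/
abbrev Z3 : Type := Multiplicative (Fin 3 → ℤ)

/-- The action of `SL₃(ℤ)` on the column vectors `ℤ³`. -/
def slAction : SL(3, ℤ) →* MulAut Z3 where
  toFun M := AddEquiv.toMultiplicative (Matrix.SpecialLinearGroup.toLin' M).toAddEquiv
  map_one' := by
    ext x
    simp
  map_mul' M N := by
    ext x
    simp

theorem slAction_apply (M : SL(3, ℤ)) (v : Fin 3 → ℤ) :
    slAction M (Multiplicative.ofAdd v) = Multiplicative.ofAdd (M.1.mulVec v) := rfl

/-- The action of `Γ₂(p)` on `ℤ³` through `T`. -/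
def sym2Action (p : ℕ) : Gamma2 p →* MulAut Z3 :=
  (slAction.comp sym2).comp (Gamma2 p).subtype

end Siegel

end

/-! A matrix in `G₁ ∩ Γ(p)` has diagonal blocks of determinant 1: over ℤ the determinants are ±1,
and -1 is excluded modulo the odd prime p. The symplectic condition then determines the lower
diagonal block from the upper one, and makes the unipotent part a symmetric matrix M times Q. The
Levi factor acts on it by M ↦ X M Xᵀ, which is T. This is the splitting.

The cohomology comes from the Lyndon-Hochschild-Serre sequence of N ⋊ Γ with N = ℤ³ and Γ = Γ₂(p).
Since Γ meets the stabilizers in the tree of SL₂(ℤ) trivially, it has cohomological dimension one,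
and only two columns survive: 0 → H¹(Γ, Hⁿ(N)) → Hⁿ⁺¹(N ⋊ Γ) → Hⁿ⁺¹(N)^Γ → 0. Dimension one is used
in the form `LiftsCrossedHoms`, the right exactness of H¹ on the level of cocycles. With it,
`hasShortExact_semidirect` follows from inflation-restriction and dimension shifting, and no
spectral sequence has to be built.

The tree enters only through `exists_primitive`. Edges are elements of SL₂(ℤ) up to sign, vertices
are cosets of ⟨S⟩ and ⟨U⟩, and every function on edges has a primitive on vertices; this is the
content of PSL₂(ℤ) = ℤ/2 * ℤ/3. Integrating an equivariant function on edges proves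
`ActsFreely.liftsCrossedHoms`. Counting ranks on the finite quotient graph proves `finrank_hom`,
hence the rank of Hom(Γ₂(p), ℤ).

What remains is Hⁿ(ℤ³) as a Γ-module. It is free of rank binom(3, n), so it vanishes for n ≥ 4. In
degrees 0 and 3 it is ℤ with trivial action, because det T = 1. In degrees 1 and 2 two unipotent
matrices already leave no invariants. Substituting this in the short exact sequences gives the
table. -/

noncomputable section

/-! ### The action of Γ on the cohomology of the normal factor of N ⋊ Γ -/

section

open CategoryTheory

namespace groupCohomology

section Elements

variable {k G : Type} [CommRing k] [Group G] (A : Rep.{0} k G)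

theorem exists_eq_π {n : ℕ} (x : groupCohomology A n) :
    ∃ (f : (Fin n → G) → A) (h : inhomogeneousCochains.d A n f = 0),
      x = π A n (cocyclesMk f h) := by
  induction x using groupCohomology_induction_on with | h z =>
  have hz : inhomogeneousCochains.d A n (iCocycles A n z) = 0 := by
    rw [← inhomogeneousCochains.d_def]
    exact ConcreteCategory.congr_hom ((inhomogeneousCochains A).iCycles_d n (n + 1)) z
  refine ⟨iCocycles A n z, hz, congrArg _ ?_⟩
  apply (ModuleCat.mono_iff_injective (iCocycles A n)).1 inferInstance
  rw [iCocycles_mk]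

theorem π_eq_zero_of_eq_d {n : ℕ} (f : (Fin (n + 1) → G) → A)
    (h : inhomogeneousCochains.d A (n + 1) f = 0) (g : (Fin n → G) → A)
    (hg : inhomogeneousCochains.d A n g = f) : π A (n + 1) (cocyclesMk f h) = 0 := by
  have e : cocyclesMk f h = toCocycles A n (n + 1) g := by
    apply (ModuleCat.mono_iff_injective (iCocycles A (n + 1))).1 inferInstance
    rw [iCocycles_mk, ← hg, ← inhomogeneousCochains.d_def]
    exact (ConcreteCategory.congr_hom ((inhomogeneousCochains A).toCycles_i n (n + 1)) g).symm
  rw [e]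
  exact ConcreteCategory.congr_hom
    ((inhomogeneousCochains A).toCycles_comp_homologyπ n (n + 1)) g

theorem map_π_cocyclesMk {H : Type} [Group H] {A} {B : Rep.{0} k H} (α : H →* G)
    (ψ : Rep.res α A ⟶ B) {n : ℕ} (f : (Fin n → G) → A)
    (h : inhomogeneousCochains.d A n f = 0) :
    ∃ h' : inhomogeneousCochains.d B n (fun x => ψ.hom (f (α ∘ x))) = 0,
      map α ψ n (π A n (cocyclesMk f h)) = π B n (cocyclesMk _ h') := by
  have h' : inhomogeneousCochains.d B n (fun x => ψ.hom (f (α ∘ x))) = 0 := by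
    have := ConcreteCategory.congr_hom ((cochainsMap α ψ).comm n (n + 1)) f
    rw [inhomogeneousCochains.d_def, inhomogeneousCochains.d_def] at this
    refine this.trans ?_
    change (cochainsMap α ψ).f (n + 1) (inhomogeneousCochains.d A n f) = 0
    rw [h, map_zero]
  refine ⟨h', ?_⟩
  rw [π_map_apply]
  congr 1
  apply (ModuleCat.mono_iff_injective (iCocycles B n)).1 inferInstance
  rw [iCocycles_mk]
  have := ConcreteCategory.congr_hom
    (HomologicalComplex.cyclesMap_i (cochainsMap α ψ) n) (cocyclesMk f h)
  refine this.trans ?_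
  change (cochainsMap α ψ).f n (iCocycles A n (cocyclesMk f h)) = _
  rw [iCocycles_mk]
  rfl

end Elements

/-- Every crossed homomorphism `Γ → N` lifts along every surjection `M → N` of
`Γ`-representations. -/
def LiftsCrossedHoms (k Γ : Type) [CommRing k] [Group Γ] : Prop :=
  ∀ (M N : Rep.{0} k Γ) (f : M ⟶ N), Function.Surjective f.hom →
    ∀ c : cocycles₁ N, ∃ c' : cocycles₁ M, ∀ g, f.hom (c' g) = c g

section Semidirect

variable {k N Γ : Type} [CommRing k] [Group N] [Group Γ] {φ : Γ →* MulAut N}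

open SemidirectProduct

/-- Conjugation by `g : Γ` on the coefficients of the restriction to `N` of a representation of
`N ⋊ Γ`. -/
def conjMap (A : Rep.{0} k (N ⋊[φ] Γ)) (g : Γ) :
    Rep.res (φ g⁻¹).toMonoidHom (Rep.res inl A) ⟶ Rep.res (inl : N →* N ⋊[φ] Γ) A :=
  Rep.ofHom ⟨A.ρ (inr g), fun n => by
    change A.ρ (inr g) * A.ρ (inl (φ g⁻¹ n)) = A.ρ (inl n) * A.ρ (inr g)
    rw [← map_mul, ← map_mul]
    congr 1
    ext <;> simp⟩

/-- The action of `Γ` on `Hⁿ(N, A)` for a representation `A` of `N ⋊ Γ`. -/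
def conjAction (A : Rep.{0} k (N ⋊[φ] Γ)) (n : ℕ) :
    Representation k Γ (groupCohomology (Rep.res (inl : N →* N ⋊[φ] Γ) A) n) where
  toFun g := (map (φ g⁻¹).toMonoidHom (conjMap A g) n).hom
  map_one' := by
    have := map_congr (f := (φ (1 : Γ)⁻¹).toMonoidHom) (g := MonoidHom.id N) (φ := conjMap A 1)
      (ψ := 𝟙 _) (by ext; simp) (by ext x; simp [conjMap]) n
    rw [this]
    exact congrArg ModuleCat.Hom.hom (map_id n)
  map_mul' g h := by
    have := map_comp (φ h⁻¹).toMonoidHom (φ g⁻¹).toMonoidHom (conjMap A h) (conjMap A g) n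
    rw [map_congr (f := (φ (g * h)⁻¹).toMonoidHom)
      (g := (φ h⁻¹).toMonoidHom.comp (φ g⁻¹).toMonoidHom) (φ := conjMap A (g * h))
      (ψ := (Rep.resFunctor (φ g⁻¹).toMonoidHom).map (conjMap A h) ≫ conjMap A g)
      (by ext; simp) (by ext x; simp [conjMap]) n, this]
    rfl

abbrev conjRep (A : Rep.{0} k (N ⋊[φ] Γ)) (n : ℕ) : Rep.{0} k Γ := Rep.of (conjAction A n)

/-- Naturality of conjugation on cochains. Stated for complexes rather than for cohomology, it
serves both the equivariance of induced maps and that of connecting homomorphisms. -/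
theorem conjMap_comm {A B : Rep.{0} k (N ⋊[φ] Γ)} (f : A ⟶ B) (g : Γ) :
    cochainsMap (φ g⁻¹).toMonoidHom (conjMap A g) ≫
        cochainsMap (MonoidHom.id N) (Rep.resMap inl f) =
      cochainsMap (MonoidHom.id N) (Rep.resMap inl f) ≫
        cochainsMap (φ g⁻¹).toMonoidHom (conjMap B g) := by
  rw [← cochainsMap_comp, ← cochainsMap_comp]
  refine cochainsMap_congr (by ext; simp) ?_
  ext x
  exact Rep.hom_comm_apply f (inr g) x

/-- The map on `Γ`-representations `Hⁿ(N, A) → Hⁿ(N, B)` induced by `A ⟶ B`. -/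
def conjRepMap {A B : Rep.{0} k (N ⋊[φ] Γ)} (f : A ⟶ B) (n : ℕ) : conjRep A n ⟶ conjRep B n :=
  Rep.ofHom ⟨(map (MonoidHom.id N) (Rep.resMap inl f) n).hom, fun g => by
    have := congrArg (fun F => ModuleCat.Hom.hom (HomologicalComplex.homologyMap F n)) (conjMap_comm f g)
    simp only [HomologicalComplex.homologyMap_comp, ModuleCat.hom_comp] at this
    exact this⟩

theorem shortExact_resInl {X : ShortComplex (Rep.{0} k (N ⋊[φ] Γ))} (hX : X.ShortExact) :
    (X.map (Rep.resFunctor (inl : N →* N ⋊[φ] Γ))).ShortExact :=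
  (Rep.shortExact_res _).2 hX

/-- Conjugation as a morphism of short complexes of cochain complexes. -/
def conjShortComplex (X : ShortComplex (Rep.{0} k (N ⋊[φ] Γ))) (g : Γ) :
    (X.map (Rep.resFunctor (inl : N →* N ⋊[φ] Γ))).map (cochainsFunctor k N) ⟶
      (X.map (Rep.resFunctor (inl : N →* N ⋊[φ] Γ))).map (cochainsFunctor k N) where
  τ₁ := cochainsMap (φ g⁻¹).toMonoidHom (conjMap X.X₁ g)
  τ₂ := cochainsMap (φ g⁻¹).toMonoidHom (conjMap X.X₂ g)
  τ₃ := cochainsMap (φ g⁻¹).toMonoidHom (conjMap X.X₃ g)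
  comm₁₂ := conjMap_comm X.f g
  comm₂₃ := conjMap_comm X.g g

/-- The connecting homomorphism of `N`-cohomology is `Γ`-equivariant. -/
def conjRepδ {X : ShortComplex (Rep.{0} k (N ⋊[φ] Γ))} (hX : X.ShortExact) (n : ℕ) :
    conjRep X.X₃ n ⟶ conjRep X.X₁ (n + 1) :=
  Rep.ofHom ⟨(δ (shortExact_resInl hX) n (n + 1) rfl).hom, fun g => by
    have := HomologicalComplex.HomologySequence.δ_naturality (conjShortComplex X g)
      (map_cochainsFunctor_shortExact (shortExact_resInl hX))
      (map_cochainsFunctor_shortExact (shortExact_resInl hX)) n (n + 1) rfl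
    exact (congrArg ModuleCat.Hom.hom this).symm⟩

end Semidirect

end groupCohomology

end

/-! ### Coinduced modules, dimension shifting and right exactness of H¹ -/

section

open CategoryTheory

namespace groupCohomology

section Coind

variable {k G : Type} [CommRing k] [Group G]

/-- The representation of `G` on the functions `G → M` by right translation. -/
def funRep (k G M : Type) [CommRing k] [Group G] [AddCommGroup M] [Module k M] : Rep.{0} k G :=
  Rep.of (X := G → M)
    { toFun g := LinearMap.funLeft k M (fun x => x * g)
      map_one' := LinearMap.ext fun f => funext fun x => congrArg f (mul_one x)
      map_mul' g h := LinearMap.ext fun f => funext fun x => congrArg f (mul_assoc x g h).symm }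

/-- The embedding of a representation into the functions on the group. -/
def toFunRep (A : Rep.{0} k G) : A ⟶ funRep k G A :=
  Rep.ofHom (σ := (funRep k G A).ρ) ⟨LinearMap.pi fun x => A.ρ x, fun g => by
    refine LinearMap.ext fun a => funext fun x => ?_
    change A.ρ x (A.ρ g a) = A.ρ (x * g) a
    simp⟩

instance (A : Rep.{0} k G) : Mono (toFunRep A) := by
  rw [Rep.mono_iff_injective]
  intro a b h
  have : A.ρ 1 a = A.ρ 1 b := congrFun h 1
  simpa using this

/-- The dimension shifting sequence `A → (G → A) → Q`. -/
def shiftComplex (A : Rep.{0} k G) : ShortComplex (Rep.{0} k G) :=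
  ShortComplex.mk (toFunRep A) (Limits.cokernel.π (toFunRep A)) (Limits.cokernel.condition _)

theorem shiftComplex_shortExact (A : Rep.{0} k G) : (shiftComplex A).ShortExact where
  exact := ShortComplex.exact_cokernel _
  mono_f := inferInstanceAs (Mono (toFunRep A))
  epi_g := inferInstanceAs (Epi (Limits.cokernel.π (toFunRep A)))

theorem funRep_d_apply {H : Type} [Group H] (ι : H →* G) (M : Type) [AddCommGroup M] [Module k M]
    (n : ℕ) (f : (Fin n → H) → G → M) (y : Fin (n + 1) → H) (s : G) :
    (show G → M from inhomogeneousCochains.d (Rep.res ι (funRep k G M)) n f y) s =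
      f (fun i => y i.succ) (s * ι (y 0)) +
        ∑ j : Fin (n + 1), (-1 : k) ^ ((j : ℕ) + 1) • f (Fin.contractNth j (· * ·) y) s := by
  have h : ∀ F : Fin (n + 1) → G → M, (∑ j, F j) s = ∑ j, F j s :=
    fun F => Finset.sum_apply s Finset.univ F
  exact congrArg (f (fun i => y i.succ) (s * ι (y 0)) + ·)
    (h fun j => (-1 : k) ^ ((j : ℕ) + 1) • f (Fin.contractNth j (· * ·) y))

/-- The equivariant map r makes functions on G coinduced as a module over H, so there is a
contracting homotopy. Keeping ι and r general covers both the whole group (r the identity) and the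
normal factor of a semidirect product (r = `leftPart`). -/
theorem subsingleton_funRep {H : Type} [Group H] (ι : H →* G) (r : G → H)
    (hr : ∀ x h, r (x * ι h) = r x * h) (M : Type) [AddCommGroup M] [Module k M] (n : ℕ) :
    Subsingleton (groupCohomology (Rep.res ι (funRep k G M)) (n + 1)) := by
  refine subsingleton_of_forall_eq 0 fun x => ?_
  obtain ⟨f, hf, rfl⟩ := exists_eq_π _ x
  let f' : (Fin (n + 1) → H) → G → M := f
  let g : (Fin n → H) → G → M := fun y s => f' (Fin.cons (r s) y) (s * (ι (r s))⁻¹)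
  refine π_eq_zero_of_eq_d _ f hf g ?_
  funext y
  refine funext fun s => ?_
  -- The cocycle identity at (r s, y₀, …, yₙ), read at the point s · ι(r s)⁻¹: its leading term is
  -- f(y)(s) and the others are the terms of -dg(y)(s).
  have h := congrFun (congrFun hf (Fin.cons (r s) y : Fin (n + 2) → H)) (s * (ι (r s))⁻¹)
  replace h := (funRep_d_apply (k := k) ι M (n + 1) f' _ _).symm.trans h
  refine (funRep_d_apply (k := k) ι M n g y s).trans ?_
  have e0 : Fin.contractNth 0 (· * ·) (Fin.cons (r s) y : Fin (n + 2) → H) =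
      Fin.cons (r s * y 0) fun i => y i.succ := by
    ext i
    refine Fin.cases ?_ (fun i => ?_) i
    · simp [Fin.contractNth]
    · simp [Fin.contractNth]
  have e1 : ∀ j : Fin (n + 1),
      Fin.contractNth j.succ (· * ·) (Fin.cons (r s) y : Fin (n + 2) → H) =
        Fin.cons (r s) (Fin.contractNth j (· * ·) y) := by
    intro j
    ext i
    refine Fin.cases ?_ (fun i => ?_) i
    · simp [Fin.contractNth]
    · simp [Fin.contractNth]
  rw [Fin.sum_univ_succ, e0] at h
  simp only [e1, Fin.cons_zero, Fin.cons_succ, inv_mul_cancel_right, Fin.val_zero, zero_add,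
    pow_one, Fin.val_succ, neg_smul, one_smul] at h
  have h2 : ∀ j : Fin (n + 1), (-1 : k) ^ ((j : ℕ) + 1 + 1) •
      f' (Fin.cons (r s) (Fin.contractNth j (· * ·) y)) (s * (ι (r s))⁻¹) =
        -((-1 : k) ^ ((j : ℕ) + 1) • g (Fin.contractNth j (· * ·) y) s) := by
    intro j
    rw [pow_succ, mul_neg_one, neg_smul]
  rw [Finset.sum_congr rfl fun j _ => h2 j, Finset.sum_neg_distrib] at h
  have h3 : g (fun i => y i.succ) (s * ι (y 0)) =
      f' (Fin.cons (r s * y 0) fun i => y i.succ) (s * (ι (r s))⁻¹) := by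
    simp only [g, hr, map_mul, mul_inv_rev]
    congr 1
    group
  rw [h3]
  have h4 : f' y s + (-f' (Fin.cons (r s * y 0) fun i => y i.succ) (s * (ι (r s))⁻¹) +
      -∑ j : Fin (n + 1), (-1 : k) ^ ((j : ℕ) + 1) • g (Fin.contractNth j (· * ·) y) s) = 0 := h
  rw [← neg_add, ← sub_eq_add_neg, sub_eq_zero] at h4
  exact h4.symm

end Coind

section CrossedHoms

variable {k Γ : Type} [CommRing k] [Group Γ]

theorem map_H1π {A B : Rep.{0} k Γ} (f : A ⟶ B) (c : cocycles₁ A) :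
    ∃ c' : cocycles₁ B, (∀ g, c' g = f.hom (c g)) ∧
      map (MonoidHom.id Γ) f 1 (H1π A c) = H1π B c' :=
  ⟨mapCocycles₁ (MonoidHom.id Γ) f c, fun _ => rfl, H1π_comp_map_apply _ _ _⟩

theorem H1π_eq_zero_iff' {A : Rep.{0} k Γ} (c : cocycles₁ A) :
    H1π A c = 0 ↔ ∃ a : A, ∀ g, c g = A.ρ g a - a := by
  rw [H1π_eq_zero_iff]
  constructor
  · rintro ⟨a, ha⟩
    exact ⟨a, fun g => (congrFun ha g).symm⟩
  · rintro ⟨a, ha⟩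
    exact ⟨a, funext fun g => (ha g).symm⟩

/-- If `H¹` is right exact and `M₁ → M₂ → M₃ → 0` is exact with `H¹(Γ, M₁) = 0`, then
`H¹(Γ, M₂) → H¹(Γ, M₃)` is bijective. -/
theorem map_one_bijective (hΓ : LiftsCrossedHoms k Γ) {M₁ M₂ M₃ : Rep.{0} k Γ} (f : M₁ ⟶ M₂)
    (g : M₂ ⟶ M₃) (hg : Function.Surjective g.hom) (hfg : Function.Exact f.hom g.hom)
    (h₁ : Subsingleton (groupCohomology M₁ 1)) :
    Function.Bijective (map (MonoidHom.id Γ) g 1) := by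
  constructor
  · rw [injective_iff_map_eq_zero]
    intro x hx
    induction x using H1_induction_on with | h c =>
    obtain ⟨c', hc', e⟩ := map_H1π g c
    rw [e, H1π_eq_zero_iff'] at hx
    obtain ⟨a, ha⟩ := hx
    obtain ⟨b, rfl⟩ := hg a
    let W : Submodule k M₂ := LinearMap.range f.hom.toLinearMap
    have hW : ∀ γ, W ≤ W.comap (M₂.ρ γ) := by
      rintro γ _ ⟨x, rfl⟩
      exact ⟨M₁.ρ γ x, Rep.hom_comm_apply f γ x⟩
    let f' : M₁ ⟶ Rep.subrepresentation M₂ W hW :=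
      Rep.ofHom ⟨f.hom.toLinearMap.rangeRestrict, fun γ => by
        ext x
        exact Rep.hom_comm_apply f γ x⟩
    -- After subtracting the coboundary of b, the crossed homomorphism dies in M₃, hence takes
    -- values in the image W of M₁. It lifts to M₁, where it is principal by hypothesis.
    have hmem : ∀ γ, c γ - (M₂.ρ γ b - b) ∈ W := fun γ => by
      refine (hfg _).1 ?_
      rw [map_sub, map_sub, Rep.hom_comm_apply, ← hc', ha, sub_self]
    have hc : ∀ γ δ, c (γ * δ) = M₂.ρ γ (c δ) + c γ := (mem_cocycles₁_iff _).1 c.2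
    obtain ⟨d, hd⟩ := hΓ _ _ f' f.hom.toLinearMap.surjective_rangeRestrict
      ⟨fun γ => ⟨_, hmem γ⟩, by
        rw [mem_cocycles₁_iff]
        intro γ δ
        refine Subtype.ext ?_
        change c (γ * δ) - (M₂.ρ (γ * δ) b - b) =
          M₂.ρ γ (c δ - (M₂.ρ δ b - b)) + (c γ - (M₂.ρ γ b - b))
        rw [hc γ δ]
        simp only [map_mul, Module.End.mul_apply, map_sub]
        abel⟩
    obtain ⟨m, hm⟩ := (H1π_eq_zero_iff' d).1 (Subsingleton.elim _ _)
    rw [H1π_eq_zero_iff']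
    refine ⟨f.hom m + b, fun γ => ?_⟩
    have : f.hom (d γ) = c γ - (M₂.ρ γ b - b) := congrArg Subtype.val (hd γ)
    rw [hm, map_sub, Rep.hom_comm_apply] at this
    rw [map_add]
    rw [eq_sub_iff_add_eq] at this
    rw [← this]
    abel
  · intro x
    induction x using H1_induction_on with | h c =>
    obtain ⟨c', hc'⟩ := hΓ _ _ g hg c
    obtain ⟨c'', h1, h2⟩ := map_H1π g c'
    refine ⟨H1π _ c', h2.trans (congrArg _ (cocycles₁_ext fun γ => (h1 γ).trans (hc' γ)))⟩

end CrossedHoms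

end groupCohomology

end

/-! ### Inflation-restriction and the short exact sequences of a semidirect product -/

section

open CategoryTheory

/-- There is a short exact sequence `0 → A → B → C → 0` of abelian groups. -/
def HasShortExact (A B C : Type) [AddCommGroup A] [AddCommGroup B] [AddCommGroup C] : Prop :=
  ∃ (i : A →+ B) (π : B →+ C), Function.Injective i ∧ Function.Exact i π ∧ Function.Surjective π

theorem HasShortExact.congr {A B C A' B' C' : Type} [AddCommGroup A]
    [AddCommGroup B] [AddCommGroup C] [AddCommGroup A'] [AddCommGroup B'] [AddCommGroup C']
    (h : HasShortExact A B C) (eA : A ≃+ A') (eB : B ≃+ B') (eC : C ≃+ C') :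
    HasShortExact A' B' C' := by
  obtain ⟨i, π, hi, hex, hπ⟩ := h
  refine ⟨eB.toAddMonoidHom.comp (i.comp eA.symm.toAddMonoidHom),
    eC.toAddMonoidHom.comp (π.comp eB.symm.toAddMonoidHom),
    eB.injective.comp (hi.comp eA.symm.injective), fun b => ?_,
    eC.surjective.comp (hπ.comp eB.symm.surjective)⟩
  have := hex (eB.symm b)
  change eC (π (eB.symm b)) = 0 ↔ ∃ a, eB (i (eA.symm a)) = b
  rw [map_eq_zero_iff eC eC.injective, this]
  constructor
  · rintro ⟨a, ha⟩
    exact ⟨eA a, by simp [ha]⟩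
  · rintro ⟨a, rfl⟩
    exact ⟨eA.symm a, by simp⟩

namespace groupCohomology

variable {k N Γ : Type} [CommRing k] [Group N] [Group Γ] {φ : Γ →* MulAut N}

open SemidirectProduct

section LowDegree

variable (A : Rep.{0} k (N ⋊[φ] Γ))

/-- The underlying vector of a class in degree zero. -/
def H0val {G : Type} [Group G] (B : Rep.{0} k G) : groupCohomology B 0 →ₗ[k] B :=
  B.ρ.invariants.subtype ∘ₗ (H0Iso B).hom.hom

theorem H0val_injective {G : Type} [Group G] (B : Rep.{0} k G) :
    Function.Injective (H0val B) :=
  Subtype.val_injective.comp ((ModuleCat.mono_iff_injective (H0Iso B).hom).1 inferInstance)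

theorem ρ_H0val {G : Type} [Group G] (B : Rep.{0} k G) (x : groupCohomology B 0) (g : G) :
    B.ρ g (H0val B x) = H0val B x :=
  ((H0Iso B).hom x).2 g

theorem exists_H0val_eq {G : Type} [Group G] (B : Rep.{0} k G) (b : B) (hb : ∀ g, B.ρ g b = b) :
    ∃ x, H0val B x = b :=
  ⟨(H0Iso B).inv ⟨b, hb⟩, by
    have h := ConcreteCategory.congr_hom (H0Iso B).inv_hom_id (⟨b, hb⟩ : B.ρ.invariants)
    exact congrArg Subtype.val h⟩

theorem H0val_map {G H : Type} [Group G] [Group H] {B : Rep.{0} k G} {C : Rep.{0} k H}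
    (f : H →* G) (ψ : Rep.res f B ⟶ C) (x : groupCohomology B 0) :
    H0val C (map f ψ 0 x) = ψ.hom (H0val B x) :=
  ConcreteCategory.congr_hom (map_H0Iso_hom_f f ψ) x

theorem H0val_conjAction (g : Γ) (x : groupCohomology (Rep.res (inl : N →* N ⋊[φ] Γ) A) 0) :
    H0val (Rep.res inl A) (conjAction A 0 g x) = A.ρ (inr g) (H0val (Rep.res inl A) x) :=
  H0val_map _ (conjMap A g) x

theorem ρ_H0val_res (x : groupCohomology (Rep.res (inl : N →* N ⋊[φ] Γ) A) 0) (n : N) :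
    A.ρ (inl n) (H0val (Rep.res inl A) x) = H0val (Rep.res inl A) x :=
  ρ_H0val (Rep.res inl A) x n

theorem ρ_eq_inl_inr (g : N ⋊[φ] Γ) (a : A) :
    A.ρ g a = A.ρ (inl g.left) (A.ρ (inr g.right) a) := by
  conv_lhs => rw [← inl_left_mul_inr_right g, map_mul]
  rfl

/-- Inflation of coefficients from `H⁰(N, A)` to `A`. -/
def inflMap : Rep.res (rightHom : N ⋊[φ] Γ →* Γ) (conjRep A 0) ⟶ A :=
  Rep.ofHom ⟨H0val (Rep.res inl A), fun g => LinearMap.ext fun x => by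
    change H0val (Rep.res inl A) (conjAction A 0 g.right x) = A.ρ g (H0val (Rep.res inl A) x)
    rw [H0val_conjAction, ρ_eq_inl_inr A g, ← H0val_conjAction A g.right x, ρ_H0val_res]⟩

theorem map_H1π' {G H : Type} [Group G] [Group H] {A : Rep.{0} k G} {B : Rep.{0} k H}
    (f : H →* G) (ψ : Rep.res f A ⟶ B) (c : cocycles₁ A) :
    ∃ c' : cocycles₁ B, (∀ g, c' g = ψ.hom (c (f g))) ∧ map f ψ 1 (H1π A c) = H1π B c' :=
  ⟨mapCocycles₁ f ψ c, fun _ => rfl, H1π_comp_map_apply _ _ _⟩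

theorem cocycle_mul {G : Type} [Group G] {B : Rep.{0} k G} (c : cocycles₁ B) (g h : G) :
    c (g * h) = B.ρ g (c h) + c g := (mem_cocycles₁_iff _).1 c.2 g h

/-- Expanding c on the two sides of γ · (γ⁻¹nγ) = n · γ shows that γ moves the restriction of c by
the principal crossed homomorphism of c(γ). -/
theorem res_mem_invariants (x : groupCohomology A 1) :
    map (inl : N →* N ⋊[φ] Γ) (𝟙 _) 1 x ∈ (conjRep A 1).ρ.invariants := by
  induction x using H1_induction_on with | h c =>
  intro g
  obtain ⟨c', hc', e⟩ := map_H1π' (inl : N →* N ⋊[φ] Γ) (𝟙 (Rep.res inl A)) c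
  rw [e]
  obtain ⟨d, hd, e'⟩ := map_H1π' (φ g⁻¹).toMonoidHom (conjMap A g) c'
  refine Eq.trans e' ?_
  rw [← sub_eq_zero, ← map_sub, H1π_eq_zero_iff']
  refine ⟨(c (inr g) : A), fun n => ?_⟩
  change d n - c' n = A.ρ (inl n) (c (inr g)) - c (inr g)
  rw [hd, hc', hc']
  change A.ρ (inr g) (c (inl (φ g⁻¹ n))) - c (inl n) = _
  have h1 := cocycle_mul c (inr g) (inl (φ g⁻¹ n))
  have h2 := cocycle_mul c (inl n) (inr g)
  have h3 : (inr g * inl (φ g⁻¹ n) : N ⋊[φ] Γ) = inl n * inr g := by ext <;> simp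
  rw [h3, h2] at h1
  rw [sub_eq_sub_iff_add_eq_add, ← h1]

/-- The extension of a crossed homomorphism to a semidirect product. -/
theorem exists_extension (hΓ : LiftsCrossedHoms k Γ) (x : (conjRep A 1).ρ.invariants) :
    ∃ y : groupCohomology A 1, map (inl : N →* N ⋊[φ] Γ) (𝟙 _) 1 y = x.1 := by
  obtain ⟨x, hx⟩ := x
  induction x using H1_induction_on with | h f =>
  -- the action on cochains
  let W : Rep.{0} k Γ := Rep.of (X := N → A)
    { toFun g := LinearMap.pi fun n => A.ρ (inr g) ∘ₗ LinearMap.proj (φ g⁻¹ n)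
      map_one' := LinearMap.ext fun F => funext fun n => by simp
      map_mul' g h := LinearMap.ext fun F => funext fun n => by simp }
  have hW : ∀ (γ : Γ) (F : N → A) (n : N),
      (show N → A from W.ρ γ F) n = A.ρ (inr γ) (F (φ γ⁻¹ n)) := fun _ _ _ => rfl
  -- D sends a to its principal crossed homomorphism on N. Invariance of the class of F says that γF
  -- - F lies in the image R of D for every γ; as a function of γ it is a crossed homomorphism into
  -- R, and the hypothesis on Γ lifts it along D to u : Γ → A.
  let D : A →ₗ[k] (N → A) := LinearMap.pi fun n => A.ρ (inl n) - LinearMap.id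
  have hD : ∀ a n, D a n = A.ρ (inl n) a - a := fun _ _ => rfl
  have hDW : ∀ γ a, W.ρ γ (D a) = D (A.ρ (inr γ) a) := fun γ a => funext fun n => by
    refine (hW γ (D a) n).trans ?_
    rw [hD, hD, map_sub, ← Module.End.mul_apply, ← map_mul, ← Module.End.mul_apply, ← map_mul]
    congr 3
    ext <;> simp
  let R : Submodule k W := LinearMap.range D
  have hR : ∀ γ, R ≤ R.comap (W.ρ γ) := by
    rintro γ _ ⟨a, rfl⟩
    exact ⟨A.ρ (inr γ) a, (hDW γ a).symm⟩
  let D' : Rep.res inr A ⟶ Rep.subrepresentation W R hR :=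
    Rep.ofHom ⟨D.rangeRestrict, fun γ => LinearMap.ext fun a => Subtype.ext (hDW γ a).symm⟩
  let F : N → A := f
  have hmem : ∀ γ, (W.ρ γ F - F : N → A) ∈ R := fun γ => by
    obtain ⟨d, hd, e⟩ := map_H1π' (φ γ⁻¹).toMonoidHom (conjMap A γ) f
    have h := hx γ
    have h' := e.symm.trans h
    rw [← sub_eq_zero, ← map_sub, H1π_eq_zero_iff'] at h'
    obtain ⟨a, ha⟩ := h'
    refine ⟨a, funext fun n => ?_⟩
    rw [hD]
    refine (ha n).symm.trans ?_
    change d n - f n = _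
    rw [hd]
    rfl
  obtain ⟨u, hu⟩ := hΓ _ _ D' D.surjective_rangeRestrict ⟨fun γ => ⟨_, hmem γ⟩, by
    rw [mem_cocycles₁_iff]
    intro γ δ
    refine Subtype.ext ?_
    change W.ρ (γ * δ) F - F = W.ρ γ (W.ρ δ F - F) + (W.ρ γ F - F)
    rw [map_mul, Module.End.mul_apply, map_sub]
    abel⟩
  have hu' : ∀ γ n, A.ρ (inl n) (u γ) - u γ = A.ρ (inr γ) (F (φ γ⁻¹ n)) - F n := fun γ n =>
    congrFun (congrArg Subtype.val (hu γ)) n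
  have hf : ∀ m n, F (m * n) = A.ρ (inl m) (F n) + F m := cocycle_mul f
  have hum : ∀ γ δ, (u (γ * δ) : A) = A.ρ (inr γ) (u δ) + u γ := cocycle_mul u
  -- The formula is forced: a cocycle equal to F on N and to u on Γ takes the value F(n) + n·u(γ) at
  -- nγ. The relation D(u γ) = γF - F is the compatibility it needs.
  have hc : (fun g => F g.left + A.ρ (inl g.left) (u g.right) : N ⋊[φ] Γ → A) ∈ cocycles₁ A := by
    rw [mem_cocycles₁_iff]
    intro g h
    have e := hu' g.right (φ g.right h.left)
    simp only [map_inv, MulAut.inv_apply_self] at e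
    change F (g.left * φ g.right h.left) + A.ρ (inl (g.left * φ g.right h.left))
      (u (g.right * h.right)) = A.ρ g (F h.left + A.ρ (inl h.left) (u h.right)) +
        (F g.left + A.ρ (inl g.left) (u g.right))
    have e2 : A.ρ (inl (φ g.right h.left)) (A.ρ (inr g.right) (u h.right)) =
        A.ρ (inr g.right) (A.ρ (inl h.left) (u h.right)) := by
      rw [← Module.End.mul_apply, ← map_mul, ← Module.End.mul_apply, ← map_mul]
      congr 2
      ext <;> simp
    rw [hf, hum, ρ_eq_inl_inr A g, map_mul inl, map_mul A.ρ, Module.End.mul_apply, map_add,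
      map_add, e2, sub_eq_iff_eq_add.1 e]
    simp only [map_add, map_sub]
    abel
  obtain ⟨c', h1, h2⟩ := map_H1π' (inl : N →* N ⋊[φ] Γ) (𝟙 (Rep.res inl A)) ⟨_, hc⟩
  refine ⟨H1π A ⟨_, hc⟩, h2.trans (congrArg _ (cocycles₁_ext fun n => (h1 n).trans ?_))⟩
  change F n + A.ρ (inl n) (u 1) = F n
  rw [cocycles₁_map_one, map_zero, add_zero]

/-- Inflation-restriction in degree one. The obstruction to surjectivity of restriction would lie in
H²(Γ, A^N); `exists_extension` removes it. -/
theorem hasShortExact_one (hΓ : LiftsCrossedHoms k Γ) :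
    HasShortExact (groupCohomology (conjRep A 0) 1) (groupCohomology A 1)
      (conjRep A 1).ρ.invariants := by
  refine ⟨(map (rightHom : N ⋊[φ] Γ →* Γ) (inflMap A) 1).hom.toAddMonoidHom,
    ((map (inl : N →* N ⋊[φ] Γ) (𝟙 _) 1).hom.codRestrict _
      (res_mem_invariants A)).toAddMonoidHom, ?_, ?_, ?_⟩
  · rw [injective_iff_map_eq_zero]
    intro x hx
    induction x using H1_induction_on with | h c =>
    obtain ⟨c', hc', e⟩ := map_H1π' (rightHom : N ⋊[φ] Γ →* Γ) (inflMap A) c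
    have h0 := e.symm.trans hx
    rw [H1π_eq_zero_iff'] at h0
    obtain ⟨a, ha⟩ := h0
    have ha' : ∀ g : N ⋊[φ] Γ, H0val (Rep.res inl A) (c g.right) = A.ρ g a - a := fun g =>
      (hc' g).symm.trans (ha g)
    obtain ⟨b, rfl⟩ := exists_H0val_eq (Rep.res inl A) a fun n => by
      have := ha' (inl n)
      rw [right_inl, cocycles₁_map_one, map_zero] at this
      exact (sub_eq_zero.1 this.symm)
    rw [H1π_eq_zero_iff']
    refine ⟨b, fun g => H0val_injective _ ?_⟩
    rw [map_sub]
    exact (ha' (inr g)).trans (congrArg (· - _) (H0val_conjAction A g b).symm)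
  · intro x
    constructor
    · intro hx
      replace hx := congrArg Subtype.val hx
      induction x using H1_induction_on with | h c =>
      obtain ⟨c', hc', e⟩ := map_H1π' (inl : N →* N ⋊[φ] Γ) (𝟙 (Rep.res inl A)) c
      have h0 : H1π (Rep.res inl A) c' = 0 := e.symm.trans hx
      rw [H1π_eq_zero_iff'] at h0
      obtain ⟨a, ha⟩ := h0
      have ha' : ∀ n : N, c (inl n) = A.ρ (inl n) a - a := fun n => (hc' n).symm.trans (ha n)
      -- The cocycle c minus the coboundary of a vanishes on N, so its values on Γ are fixed by N
      -- and it is inflated from Γ.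
      have hinv : ∀ (γ : Γ) (n : N), A.ρ (inl n) (c (inr γ) - (A.ρ (inr γ) a - a)) =
          c (inr γ) - (A.ρ (inr γ) a - a) := by
        intro γ n
        have h1 := cocycle_mul c (inr γ) (inl (φ γ⁻¹ n))
        have h2 := cocycle_mul c (inl n) (inr γ)
        have h3 : (inr γ * inl (φ γ⁻¹ n) : N ⋊[φ] Γ) = inl n * inr γ := by ext <;> simp
        have h4 : A.ρ (inr γ) (A.ρ (inl (φ γ⁻¹ n)) a) = A.ρ (inl n) (A.ρ (inr γ) a) := by
          rw [← Module.End.mul_apply, ← map_mul, ← Module.End.mul_apply, ← map_mul, h3]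
        rw [h3, h2, ha', ha', map_sub, h4] at h1
        rw [map_sub, map_sub, eq_sub_iff_add_eq.2 h1]
        abel
      choose b hb using fun γ => exists_H0val_eq (Rep.res inl A) _ (hinv γ)
      have hbc : b ∈ cocycles₁ (conjRep A 0) := by
        rw [mem_cocycles₁_iff]
        intro γ δ
        refine H0val_injective _ ?_
        rw [map_add]
        refine Eq.trans ?_ (congrArg (· + _) (H0val_conjAction A γ (b δ)).symm)
        rw [hb, hb, hb, map_mul, cocycle_mul, map_mul, Module.End.mul_apply]
        simp only [map_sub]
        abel
      obtain ⟨d, hd, e'⟩ := map_H1π' (rightHom : N ⋊[φ] Γ →* Γ) (inflMap A) ⟨b, hbc⟩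
      refine ⟨_, e'.trans ?_⟩
      rw [← sub_eq_zero, ← map_sub, H1π_eq_zero_iff']
      refine ⟨-a, fun g => ?_⟩
      change d g - c g = _
      have h1 : d g = c (inr g.right) - (A.ρ (inr g.right) a - a) := (hd g).trans (hb g.right)
      have h2 : c g = A.ρ (inl g.left) (c (inr g.right)) + (A.ρ (inl g.left) a - a) := by
        rw [← ha', ← cocycle_mul, inl_left_mul_inr_right]
      have h3 := hinv g.right g.left
      rw [h1, h2, ρ_eq_inl_inr A g, map_neg, map_neg, ← h3]
      simp only [map_sub]
      abel
    · rintro ⟨x, rfl⟩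
      refine Subtype.ext ?_
      induction x using H1_induction_on with | h c =>
      obtain ⟨c', hc', e⟩ := map_H1π' (rightHom : N ⋊[φ] Γ →* Γ) (inflMap A) c
      obtain ⟨d, hd, e'⟩ := map_H1π' (inl : N →* N ⋊[φ] Γ) (𝟙 (Rep.res inl A)) c'
      refine (congrArg (map (inl : N →* N ⋊[φ] Γ) (𝟙 _) 1).hom e).trans (e'.trans ((H1π_eq_zero_iff' d).2 ?_))
      refine ⟨0, fun n => ?_⟩
      rw [hd, map_zero, sub_zero]
      refine (hc' (inl n)).trans ?_
      rw [rightHom_inl, cocycles₁_map_one, map_zero]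
  · intro x
    obtain ⟨y, hy⟩ := exists_extension A hΓ x
    exact ⟨y, Subtype.ext hy⟩

end LowDegree

section Shift

variable {G : Type} [Group G]

theorem δ_bijective {X : ShortComplex (Rep.{0} k G)} (hX : X.ShortExact) (n : ℕ)
    (h₁ : Subsingleton (groupCohomology X.X₂ (n + 1)))
    (h₂ : Subsingleton (groupCohomology X.X₂ (n + 2))) :
    Function.Bijective (δ hX (n + 1) (n + 2) rfl) := by
  have := isIso_δ_of_isZero hX (n + 1) (ModuleCat.isZero_of_subsingleton _)
    (ModuleCat.isZero_of_subsingleton _)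
  exact ConcreteCategory.bijective_of_isIso (δ hX (n + 1) (n + 2) rfl)

/-- The projection `N ⋊ Γ → N` that is equivariant for right multiplication by `N`. -/
def leftPart (x : N ⋊[φ] Γ) : N := φ x.right⁻¹ x.left

theorem leftPart_mul_inl (x : N ⋊[φ] Γ) (n : N) : leftPart (x * inl n) = leftPart x * n := by
  simp [leftPart]

/-- Functions on N ⋊ Γ fixed by N are functions on the quotient Γ, which is again coinduced. This is
the degree zero case left open by the acyclicity of functions over N. -/
theorem subsingleton_H1_conjRep_funRep (M : Type) [AddCommGroup M] [Module k M] :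
    Subsingleton (groupCohomology (conjRep (funRep k (N ⋊[φ] Γ) M) 0) 1) := by
  refine subsingleton_of_forall_eq 0 fun x => ?_
  induction x using H1_induction_on with | h c =>
  let v : Γ → N ⋊[φ] Γ → M := fun γ => H0val (Rep.res inl (funRep k (N ⋊[φ] Γ) M)) (c γ)
  have hv : ∀ γ x n, v γ (x * inl n) = v γ x := fun γ x n =>
    congrFun (ρ_H0val_res (funRep k (N ⋊[φ] Γ) M) (c γ) n) x
  have hc : ∀ γ δ x, v (γ * δ) x = v δ (x * inr γ) + v γ x := fun γ δ x => by
    have h := congrArg (H0val (Rep.res inl (funRep k (N ⋊[φ] Γ) M))) (cocycle_mul c γ δ)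
    rw [map_add] at h
    exact congrFun (h.trans (congrArg (· + _) (H0val_conjAction _ γ (c δ)))) x
  -- The cocycle identity at the base point n reads v_{δγ}(n) = v_γ(nδ) + v_δ(n), so x = nδ ↦ v_δ(n)
  -- is a primitive.
  let b : N ⋊[φ] Γ → M := fun x => v x.right (inl x.left)
  obtain ⟨y, hy⟩ := exists_H0val_eq (Rep.res inl (funRep k (N ⋊[φ] Γ) M)) b fun n => by
    refine funext fun x => ?_
    change v (x * inl n).right (inl (x * inl n).left) = v x.right (inl x.left)
    simp only [mul_right, right_inl, mul_one, mul_left, left_inl, map_mul, hv]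
  rw [H1π_eq_zero_iff']
  refine ⟨y, fun γ => H0val_injective _ ?_⟩
  rw [map_sub]
  refine Eq.trans ?_ (congrArg (· - _) (H0val_conjAction _ γ y).symm)
  rw [hy]
  refine funext fun x => ?_
  change v γ x = v (x * inr γ).right (inl (x * inr γ).left) - v x.right (inl x.left)
  simp only [mul_right, right_inr, mul_left, left_inr, map_one, mul_one, hc,
    inl_left_mul_inr_right, add_sub_cancel_right]

/-- The action of `Γ` on the cohomology of `N` is compatible with isomorphisms. -/
def invariantsEquiv {M M' : Rep.{0} k Γ} (f : M ⟶ M') (hf : Function.Bijective f.hom) :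
    M.ρ.invariants ≃ₗ[k] M'.ρ.invariants :=
  LinearEquiv.ofBijective
    ((f.hom.toLinearMap.comp M.ρ.invariants.subtype).codRestrict M'.ρ.invariants fun x g => by
      refine (Rep.hom_comm_apply f g x.1).symm.trans ?_
      exact congrArg f.hom (x.2 g))
    ⟨fun x y h => Subtype.ext (hf.1 (congrArg Subtype.val h)), fun y => by
      obtain ⟨x, hx⟩ := hf.2 y.1
      refine ⟨⟨x, fun g => hf.1 ?_⟩, Subtype.ext hx⟩
      rw [Rep.hom_comm_apply, hx]
      exact y.2 g⟩

/-- If `H¹(Γ, -)` is right exact, the Lyndon-Hochschild-Serre spectral sequence of `N ⋊ Γ`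
degenerates to short exact sequences. -/
theorem hasShortExact_semidirect (hΓ : LiftsCrossedHoms k Γ) (n : ℕ) :
    ∀ A : Rep.{0} k (N ⋊[φ] Γ), HasShortExact (groupCohomology (conjRep A n) 1)
      (groupCohomology A (n + 1)) (conjRep A (n + 1)).ρ.invariants := by
  induction n with
  | zero => exact fun A => hasShortExact_one A hΓ
  | succ n ih =>
    intro A
    -- Dimension shifting along A → (G → A) → C, where G = N ⋊ Γ. The middle term is acyclic over
    -- both G and N, so connecting homomorphisms identify the middle and right terms of the sequence
    -- for C in degree n with those for A in degree n + 1.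
    have hX := shiftComplex_shortExact A
    have hG : ∀ m, Subsingleton (groupCohomology (shiftComplex A).X₂ (m + 1)) := fun m =>
      subsingleton_funRep (k := k) (MonoidHom.id (N ⋊[φ] Γ)) id (fun _ _ => rfl) A m
    have hN : ∀ m, Subsingleton
        (groupCohomology (Rep.res (inl : N →* N ⋊[φ] Γ) (shiftComplex A).X₂) (m + 1)) := fun m =>
      subsingleton_funRep (k := k) (inl : N →* N ⋊[φ] Γ) leftPart leftPart_mul_inl A m
    have e₁ := δ_bijective hX n (hG _) (hG _)
    have e₂ : ∀ m, Function.Bijective (conjRepδ hX (m + 1)).hom := fun m =>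
      δ_bijective (shortExact_resInl hX) m (hN _) (hN _)
    refine (ih (shiftComplex A).X₃).congr ?_ (LinearEquiv.ofBijective _ e₁).toAddEquiv
      (invariantsEquiv (conjRepδ hX (n + 1)) (e₂ n)).toAddEquiv
    -- For n = 0 the connecting map Hⁿ(N, C) → Hⁿ⁺¹(N, A) is only surjective, so the left terms are
    -- compared by right exactness of H¹(Γ, -), given that H¹(Γ, Hⁿ(N, G → A)) = 0.
    refine AddEquiv.ofBijective (map (MonoidHom.id Γ) (conjRepδ hX n) 1).hom.toAddMonoidHom
      (map_one_bijective hΓ (conjRepMap (shiftComplex A).g n) _ ?_ ?_ ?_)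
    · cases n with
      | succ n => exact (e₂ n).2
      | zero =>
        have := epi_δ_of_isZero (shortExact_resInl hX) 0 (@ModuleCat.isZero_of_subsingleton _ _ _ (hN 0))
        exact (ModuleCat.epi_iff_surjective _).1 this
    · have := mapShortComplex₃_exact (shortExact_resInl hX) (i := n) rfl
      exact (ShortComplex.ShortExact.moduleCat_exact_iff_function_exact _).1 this
    · cases n with
      | zero => exact subsingleton_H1_conjRep_funRep A
      | succ n =>
        have := hN n
        refine subsingleton_of_forall_eq 0 fun x => ?_
        induction x using H1_induction_on with | h c =>
        rw [H1π_eq_zero_iff']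
        exact ⟨0, fun g => Subsingleton.elim (α := groupCohomology
          (Rep.res (inl : N →* N ⋊[φ] Γ) (shiftComplex A).X₂) (n + 1)) _ _⟩

end Shift

end groupCohomology

end

/-! ### The integral cohomology of ℤᵏ -/

section

open CategoryTheory groupCohomology

theorem HasShortExact.nonempty_equiv_prod {A B C : Type} [AddCommGroup A] [AddCommGroup B]
    [AddCommGroup C] [Module.Projective ℤ C] (h : HasShortExact A B C) :
    Nonempty (B ≃+ A × C) := by
  obtain ⟨i, π, hi, hex, hπ⟩ := h
  obtain ⟨s, hs⟩ := Module.projective_lifting_property π.toIntLinearMap LinearMap.id hπ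
  have hex' : Function.Exact i.toIntLinearMap π.toIntLinearMap := hex
  exact ⟨(hex'.splitSurjectiveEquiv hi ⟨s, hs⟩).1.toAddEquiv⟩

theorem HasShortExact.nonempty_equiv_left {A B C : Type} [AddCommGroup A] [AddCommGroup B]
    [AddCommGroup C] [Subsingleton C] (h : HasShortExact A B C) : Nonempty (A ≃+ B) := by
  obtain ⟨i, π, hi, hex, -⟩ := h
  exact ⟨AddEquiv.ofBijective i ⟨hi, fun b => (hex b).1 (Subsingleton.elim _ _)⟩⟩

namespace groupCohomology

variable {k G : Type} [CommRing k] [Group G]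

/-- `H¹` with trivial coefficients consists of homomorphisms. -/
def H1TrivialEquiv (A : Rep.{0} k G) [A.IsTrivial] : groupCohomology A 1 ≃+ (Additive G →+ A) :=
  (H1IsoOfIsTrivial A).toLinearEquiv.toAddEquiv

/-- The invariants of a trivial representation. -/
def invariantsTrivialEquiv (A : Rep.{0} k G) [A.IsTrivial] : A.ρ.invariants ≃+ A :=
  (LinearEquiv.ofTop _ (Representation.invariants_eq_top A.ρ)).toAddEquiv

end groupCohomology

namespace Siegel

section Trivial

variable {N Γ : Type} [Group N] [Group Γ]

theorem hasShortExact_HZ (φ : Γ →* MulAut N) (hΓ : LiftsCrossedHoms ℤ Γ) (n : ℕ) :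
    HasShortExact (groupCohomology (cohomologyRep φ n) 1) (HZ (N ⋊[φ] Γ) (n + 1))
      (cohomologyRep φ (n + 1)).ρ.invariants :=
  hasShortExact_semidirect hΓ n (Rep.trivial ℤ (N ⋊[φ] Γ) ℤ)

/-- An isomorphism of groups induces an isomorphism on integral cohomology. -/
def pullbackEquiv (e : N ≃* Γ) (n : ℕ) : HZ Γ n ≃+ HZ N n :=
  (mapIso (A := Rep.trivial ℤ N ℤ) (B := Rep.trivial ℤ Γ ℤ) e.symm (LinearEquiv.refl ℤ ℤ)
    (fun _ => rfl) n).toLinearEquiv.toAddEquiv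

/-- `H⁰(G, ℤ) = ℤ`. -/
def HZZeroEquiv (G : Type) [Group G] : HZ G 0 ≃+ ℤ :=
  (H0IsoOfIsTrivial (Rep.trivial ℤ G ℤ)).toLinearEquiv.toAddEquiv

end Trivial

section Integers

/-- A crossed homomorphism on an infinite cyclic group may take any value at the generator: crossed
homomorphisms into M are sections of M ⋊ ℤ → ℤ, and ℤ is free. It is therefore enough to lift one
value. -/
theorem liftsCrossedHoms_int (k : Type) [CommRing k] :
    LiftsCrossedHoms k (Multiplicative ℤ) := by
  intro M M' f hf c
  obtain ⟨m, hm⟩ := hf (c (Multiplicative.ofAdd 1))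
  let act : Multiplicative ℤ →* MulAut (Multiplicative M) :=
    { toFun := fun g => AddEquiv.toMultiplicative
        { toFun := M.ρ g, invFun := M.ρ g⁻¹, left_inv := fun x => by simp,
          right_inv := fun x => by simp, map_add' := map_add _ }
      map_one' := by ext; simp
      map_mul' := fun g h => by ext; simp }
  let s : Multiplicative ℤ →* Multiplicative M ⋊[act] Multiplicative ℤ :=
    zpowersHom _ ⟨Multiplicative.ofAdd m, Multiplicative.ofAdd 1⟩
  have hs : ∀ g, (s g).right = g := fun g => DFunLike.congr_fun
    (f := SemidirectProduct.rightHom.comp s) (g := MonoidHom.id _)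
    (MonoidHom.ext_mint (by simp [s])) g
  let d : cocycles₁ M := ⟨fun g => (s g).left.toAdd, by
    rw [mem_cocycles₁_iff]
    intro g h
    rw [map_mul, SemidirectProduct.mul_left, hs, toAdd_mul, add_comm]
    rfl⟩
  have hd : ∀ g h, d (g * h) = M.ρ g (d h) + d g := cocycle_mul d
  have hc := cocycle_mul c
  refine ⟨d, fun g => ?_⟩
  let S : Subgroup (Multiplicative ℤ) :=
    { carrier := {g | f.hom (d g) = c g}
      one_mem' := by simp
      mul_mem' := fun {a b} ha hb => by
        change f.hom (d (a * b)) = c (a * b)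
        rw [hd, hc, map_add, Rep.hom_comm_apply, ha, hb]
      inv_mem' := fun {a} ha => by
        change f.hom (d a⁻¹) = c a⁻¹
        have h1 := hd a⁻¹ a
        have h2 := hc a⁻¹ a
        rw [inv_mul_cancel, cocycles₁_map_one] at h1 h2
        rw [← neg_eq_of_add_eq_zero_right h1.symm, ← neg_eq_of_add_eq_zero_right h2.symm, map_neg,
          Rep.hom_comm_apply, ha] }
  have h1 : Multiplicative.ofAdd (1 : ℤ) ∈ S := by
    change f.hom (s (Multiplicative.ofAdd 1)).left.toAdd = _
    simp [s, hm]
  have : g = (Multiplicative.ofAdd (1 : ℤ)) ^ g.toAdd := by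
    rw [← ofAdd_zsmul]; simp
  rw [this]
  exact S.zpow_mem h1 _

/-- `H¹(ℤ, M) = M` for a trivial module `M`. -/
def H1IntEquiv (M : Rep.{0} ℤ (Multiplicative ℤ)) [M.IsTrivial] : groupCohomology M 1 ≃+ M :=
  (H1TrivialEquiv M).trans
    { toFun := fun (f : Additive (Multiplicative ℤ) →+ M) => f (.ofMul (.ofAdd 1))
      invFun := zmultiplesHom M
      map_add' := fun _ _ => rfl
      left_inv := fun _ => AddMonoidHom.ext_int (one_zsmul _)
      right_inv := fun m => one_zsmul m }

/-- `ℤᵏ⁺¹ = ℤᵏ ⋊ ℤ` with trivial action. -/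
def finSuccEquiv (k : ℕ) : Multiplicative (Fin (k + 1) → ℤ) ≃*
    Multiplicative (Fin k → ℤ) ⋊[1] Multiplicative ℤ where
  toFun v := ⟨.ofAdd fun i => v.toAdd i.succ, .ofAdd (v.toAdd 0)⟩
  invFun w := .ofAdd (Fin.cons w.right.toAdd w.left.toAdd)
  left_inv v := by
    apply Multiplicative.toAdd.injective
    exact Fin.cons_self_tail _
  right_inv w := by
    ext <;> rfl
  map_mul' v w := by ext <;> rfl

theorem cohomologyAction_one {N Γ : Type} [Group N] [Group Γ] (n : ℕ) (g : Γ) :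
    cohomologyAction (1 : Γ →* MulAut N) n g = LinearMap.id :=
  pullback_id N n

/-- Induction on the rank through ℤᵏ⁺¹ = ℤᵏ ⋊ ℤ with trivial action: the short exact sequence
splits, and its two outer ranks add up by Pascal's rule. -/
theorem nonempty_HZ_equiv (k n : ℕ) :
    Nonempty (HZ (Multiplicative (Fin k → ℤ)) n ≃+ (Fin (k.choose n) → ℤ)) := by
  induction k generalizing n with
  | zero =>
    cases n with
    | zero => exact ⟨(HZZeroEquiv _).trans (LinearEquiv.funUnique (Fin 1) ℤ ℤ).symm.toAddEquiv⟩
    | succ n =>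
      have := ModuleCat.subsingleton_of_isZero (isZero_groupCohomology_succ_of_subsingleton
        (Rep.trivial ℤ (Multiplicative (Fin 0 → ℤ)) ℤ) n)
      have := uniqueOfSubsingleton (α := HZ (Multiplicative (Fin 0 → ℤ)) (n + 1)) 0
      rw [Nat.choose_zero_succ]
      exact ⟨AddEquiv.ofBijective (0 : _ →+ _) ⟨fun _ _ _ => Subsingleton.elim _ _,
        fun _ => ⟨0, Subsingleton.elim _ _⟩⟩⟩
  | succ k ih =>
    cases n with
    | zero =>
      rw [Nat.choose_zero_right]
      exact ⟨(HZZeroEquiv _).trans (LinearEquiv.funUnique (Fin 1) ℤ ℤ).symm.toAddEquiv⟩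
    | succ n =>
      obtain ⟨e₁⟩ := ih n
      obtain ⟨e₂⟩ := ih (n + 1)
      have htriv : ∀ n, (cohomologyRep (1 : Multiplicative ℤ →*
          MulAut (Multiplicative (Fin k → ℤ))) n).IsTrivial := fun n =>
        ⟨fun g => cohomologyAction_one n g⟩
      have := htriv n
      have h := hasShortExact_HZ (1 : Multiplicative ℤ →* MulAut (Multiplicative (Fin k → ℤ)))
        (liftsCrossedHoms_int ℤ) n
      have := htriv (n + 1)
      have h' := h.congr ((H1IntEquiv _).trans e₁) (pullbackEquiv (finSuccEquiv k) (n + 1))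
        ((invariantsTrivialEquiv _).trans e₂)
      obtain ⟨e⟩ := h'.nonempty_equiv_prod
      exact ⟨e.trans (((LinearEquiv.sumArrowLequivProdArrow _ _ ℤ ℤ).symm.trans
        (LinearEquiv.funCongrLeft ℤ ℤ (finSumFinEquiv.trans
          (finCongr (Nat.choose_succ_succ k n).symm)).symm)).toAddEquiv)⟩

end Integers

end Siegel

end

/-! ### PSL₂(ℤ) as a free product, and primitives on its tree -/

section

namespace ModularTree

open Siegel Monoid

/-- The homomorphism from a cyclic group determined by an element of finite order. -/
def cyclicHom {G : Type} [Group G] (n : ℕ) (g : G) (hg : g ^ n = 1) :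
    Multiplicative (ZMod n) →* G :=
  AddMonoidHom.toMultiplicativeLeft (ZMod.lift n ⟨zmultiplesHom (Additive G) (Additive.ofMul g), by
    simpa [← ofMul_pow] using hg⟩)

theorem cyclicHom_one {G : Type} [Group G] (n : ℕ) (g : G) (hg : g ^ n = 1) :
    cyclicHom n g hg (Multiplicative.ofAdd 1) = g := by
  have h : (ZMod.lift n ⟨zmultiplesHom (Additive G) (Additive.ofMul g), by
    simpa [← ofMul_pow] using hg⟩) ((1 : ℤ) : ZMod n) = Additive.ofMul g := by
    rw [ZMod.lift_coe]; simp
  rw [Int.cast_one] at h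
  exact congrArg Additive.toMul h

/-- The standard element of order `4` of `SL₂(ℤ)`. -/
def S : SL(2, ℤ) := ⟨!![0, -1; 1, 0], by decide⟩

/-- The standard element of order `6` of `SL₂(ℤ)`. -/
def U : SL(2, ℤ) := ⟨!![1, -1; 1, 0], by decide⟩

theorem S_sq : S ^ 2 = -1 := by decide

theorem U_cube : U ^ 3 = -1 := by decide

theorem closure_S_U : Subgroup.closure {S, U} = ⊤ := by
  rw [eq_top_iff, ← SpecialLinearGroup.SL2Z_generators, Subgroup.closure_le]
  have hS : S ∈ Subgroup.closure {S, U} := Subgroup.subset_closure (by simp)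
  have hU : U ∈ Subgroup.closure {S, U} := Subgroup.subset_closure (by simp)
  have hT : ModularGroup.T = U * S⁻¹ := by decide
  rintro x (rfl | rfl)
  · exact hS
  · rw [hT]
    exact mul_mem hU (inv_mem hS)

/-- The action of `SL₂(ℤ)` on `ℤ³` by the symmetric square. -/
def symAct : SL(2, ℤ) →* MulAut Z3 := slAction.comp sym2

theorem eq_one_or_neg_one_of_symAct {x : SL(2, ℤ)} (hx : symAct x = 1) : x = 1 ∨ x = -1 := by
  have h : ∀ v : Fin 3 → ℤ, (sym2Matrix x.1).mulVec v = v := fun v =>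
    congrArg Multiplicative.toAdd (DFunLike.congr_fun hx (Multiplicative.ofAdd v))
  have h0 := h ![1, 0, 0]
  have h1 := h ![0, 1, 0]
  have h2 := h ![0, 0, 1]
  have e1 := congrFun h0 0
  have e2 := congrFun h0 2
  have e3 := congrFun h1 1
  have e4 := congrFun h2 0
  simp [sym2Matrix, Matrix.mulVec, dotProduct, Fin.sum_univ_succ] at e1 e2 e3 e4
  rw [e2, e4] at e3
  have key : ∀ y : SL(2, ℤ), y.1 0 1 = x.1 0 1 → y.1 1 0 = x.1 1 0 → y.1 0 0 = x.1 0 0 →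
      y.1 1 1 = x.1 1 1 → x = y := fun y h1 h2 h3 h4 => by
    ext i j
    fin_cases i <;> fin_cases j
    exacts [h3.symm, h1.symm, h2.symm, h4.symm]
  rcases e1 with e1 | e1
  · refine Or.inl (key _ ?_ ?_ ?_ ?_)
    all_goals simp [e1, e2, e4] at e3 ⊢
    omega
  · refine Or.inr (key _ ?_ ?_ ?_ ?_)
    all_goals simp [e1, e2, e4] at e3 ⊢
    omega

/-- The two cyclic groups whose free product is `PSL₂(ℤ)`. -/
abbrev Cyc (i : Bool) : Type := Multiplicative (ZMod (if i then 3 else 2))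

/-- The free product of the cyclic groups of order `2` and `3`. -/
abbrev FreeProd : Type := CoprodI Cyc

def sGen : FreeProd := CoprodI.of (i := false) (Multiplicative.ofAdd (1 : ZMod 2))

def uGen : FreeProd := CoprodI.of (i := true) (Multiplicative.ofAdd (1 : ZMod 3))

/-- The universal property of the free product of cyclic groups of order `2` and `3`. -/
def liftHom {G : Type} [Group G] (s u : G) (hs : s ^ 2 = 1) (hu : u ^ 3 = 1) : FreeProd →* G :=
  CoprodI.lift fun i => match i with
    | false => cyclicHom 2 s hs
    | true => cyclicHom 3 u hu

theorem liftHom_sGen {G : Type} [Group G] (s u : G) (hs : s ^ 2 = 1) (hu : u ^ 3 = 1) :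
    liftHom s u hs hu sGen = s := by
  rw [liftHom, sGen, CoprodI.lift_of]
  exact cyclicHom_one 2 s hs

theorem liftHom_uGen {G : Type} [Group G] (s u : G) (hs : s ^ 2 = 1) (hu : u ^ 3 = 1) :
    liftHom s u hs hu uGen = u := by
  rw [liftHom, uGen, CoprodI.lift_of]
  exact cyclicHom_one 3 u hu

theorem closure_gens : Subgroup.closure {sGen, uGen} = ⊤ := by
  rw [eq_top_iff]
  intro x _
  induction x using CoprodI.induction_on with
  | one => exact one_mem _
  | mul x y hx hy => exact mul_mem (hx trivial) (hy trivial)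
  | of i m =>
    cases i with
    | false =>
      have : CoprodI.of (i := false) m = sGen ^ (ZMod.val (n := 2) m.toAdd) := by
        rw [sGen, ← map_pow]
        congr 1
        clear * -
        revert m
        decide
      rw [this]
      exact pow_mem (Subgroup.subset_closure (by simp)) _
    | true =>
      have : CoprodI.of (i := true) m = uGen ^ (ZMod.val (n := 3) m.toAdd) := by
        rw [uGen, ← map_pow]
        congr 1
        clear * -
        revert m
        decide
      rw [this]
      exact pow_mem (Subgroup.subset_closure (by simp)) _

theorem symAct_neg_one : symAct (-1) = 1 := by
  have : sym2 (-1) = 1 := by decide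
  rw [symAct, MonoidHom.comp_apply, this, map_one]

theorem symAct_S_sq : symAct S ^ 2 = 1 := by rw [← map_pow, S_sq, symAct_neg_one]

theorem symAct_U_cube : symAct U ^ 3 = 1 := by rw [← map_pow, U_cube, symAct_neg_one]

/-- The representation of the free product on `ℤ³`. -/
def freeAct : FreeProd →* MulAut Z3 :=
  liftHom (symAct S) (symAct U) symAct_S_sq symAct_U_cube

/-- The sets playing ping-pong. -/
def cone (i : Bool) : Set Z3 :=
  {v | 0 ≤ v.toAdd 0 ∧ 0 ≤ v.toAdd 2 ∧ (if i then 0 < v.toAdd 1 else v.toAdd 1 < 0)}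

theorem symAct_S_apply (v : Z3) :
    symAct S v = Multiplicative.ofAdd ![v.toAdd 2, -v.toAdd 1, v.toAdd 0] := by
  have h : (sym2 S).1 = !![0, 0, 1; 0, -1, 0; 1, 0, 0] := by decide
  refine (slAction_apply _ _).trans (congrArg _ ?_)
  rw [h]
  ext i
  fin_cases i <;> simp [Matrix.mulVec, dotProduct, Fin.sum_univ_succ] <;> rfl

theorem symAct_U_apply (v : Z3) :
    symAct U v = Multiplicative.ofAdd
      ![v.toAdd 0 - 2 * v.toAdd 1 + v.toAdd 2, v.toAdd 0 - v.toAdd 1, v.toAdd 0] := by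
  obtain ⟨v, rfl⟩ := Multiplicative.ofAdd.surjective v
  have h : (sym2 U).1 = !![1, -2, 1; 1, -1, 0; 1, 0, 0] := by decide
  refine (slAction_apply _ _).trans (congrArg _ ?_)
  rw [h]
  ext i
  fin_cases i <;> simp [Matrix.mulVec, dotProduct, Fin.sum_univ_succ] <;> ring

/-- Ping-pong on vectors (x, y, z) with x, z ≥ 0, separated by the sign of y. S reverses this sign,
while U and U² send y < 0 to x - y > 0 and z - y > 0. -/
theorem freeAct_injective : Function.Injective freeAct := by
  -- Ping-pong with two factors needs one of order at least three, here the factor ℤ/3.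
  refine CoprodI.lift_injective_of_ping_pong (α := Z3) _ (Or.inr ⟨true, ?_⟩) cone ?_ ?_ ?_
  · simp
  · intro i
    cases i
    · exact ⟨Multiplicative.ofAdd ![0, -1, 0], by simp [cone]⟩
    · exact ⟨Multiplicative.ofAdd ![0, 1, 0], by simp [cone]⟩
  · have h : Disjoint (cone true) (cone false) := Set.disjoint_left.2 fun v h1 h2 => by
      simp only [cone, Set.mem_ofPred_eq, if_true, Bool.false_eq_true, if_false] at h1 h2
      omega
    intro i j hij
    cases i <;> cases j
    exacts [absurd rfl hij, h.symm, h, absurd rfl hij]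
  · intro i j hij h hh
    rintro _ ⟨v, hv, rfl⟩
    cases i <;> cases j
    · exact absurd rfl hij
    · have : h = Multiplicative.ofAdd (1 : ZMod 2) := by
        clear * - hh
        revert h
        decide
      subst this
      change cyclicHom 2 (symAct S) symAct_S_sq (Multiplicative.ofAdd 1) v ∈ _
      rw [cyclicHom_one, symAct_S_apply]
      simp [cone] at hv ⊢
      omega
    · have : h = Multiplicative.ofAdd (1 : ZMod 3) ∨
          h = Multiplicative.ofAdd (1 : ZMod 3) * Multiplicative.ofAdd (1 : ZMod 3) := by
        clear * - hh
        revert h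
        decide
      rcases this with rfl | rfl
      · change cyclicHom 3 (symAct U) symAct_U_cube (Multiplicative.ofAdd 1) v ∈ _
        rw [cyclicHom_one, symAct_U_apply]
        simp [cone] at hv ⊢
        omega
      · change cyclicHom 3 (symAct U) symAct_U_cube
          (Multiplicative.ofAdd 1 * Multiplicative.ofAdd 1) v ∈ _
        rw [map_mul, cyclicHom_one, MulAut.mul_apply, symAct_U_apply, symAct_U_apply]
        simp [cone] at hv ⊢
        omega
    · exact absurd rfl hij

/-- Every automorphism of ℤ³ coming from SL₂(ℤ) comes from the free product, which acts faithfully.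
This yields a homomorphism from SL₂(ℤ) to the free product without a presentation of SL₂(ℤ). -/
theorem exists_freeAct_eq (x : SL(2, ℤ)) : ∃ y, freeAct y = symAct x := by
  have h : (⊤ : Subgroup SL(2, ℤ)) ≤ freeAct.range.comap symAct := by
    rw [← closure_S_U, Subgroup.closure_le]
    rintro _ (rfl | rfl)
    · exact ⟨sGen, liftHom_sGen _ _ _ _⟩
    · exact ⟨uGen, liftHom_uGen _ _ _ _⟩
  exact h (Subgroup.mem_top x)

/-- The projection of `SL₂(ℤ)` to the free product of cyclic groups of order `2` and `3`. -/
def toFreeProd : SL(2, ℤ) →* FreeProd where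
  toFun x := (exists_freeAct_eq x).choose
  map_one' := freeAct_injective (by rw [(exists_freeAct_eq 1).choose_spec, map_one, map_one])
  map_mul' x y := freeAct_injective (by
    rw [(exists_freeAct_eq (x * y)).choose_spec, map_mul, map_mul,
      (exists_freeAct_eq x).choose_spec, (exists_freeAct_eq y).choose_spec])

theorem freeAct_toFreeProd (x : SL(2, ℤ)) : freeAct (toFreeProd x) = symAct x :=
  (exists_freeAct_eq x).choose_spec

theorem toFreeProd_S : toFreeProd S = sGen :=
  freeAct_injective (by rw [freeAct_toFreeProd, freeAct, liftHom_sGen])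

theorem toFreeProd_U : toFreeProd U = uGen :=
  freeAct_injective (by rw [freeAct_toFreeProd, freeAct, liftHom_uGen])

theorem toFreeProd_eq_iff {x y : SL(2, ℤ)} (h : toFreeProd x = toFreeProd y) :
    x = y ∨ x = -1 * y := by
  have : symAct (x * y⁻¹) = 1 := by
    rw [map_mul, map_inv, ← freeAct_toFreeProd, ← freeAct_toFreeProd, h, mul_inv_cancel]
  rcases eq_one_or_neg_one_of_symAct this with h | h
  · exact Or.inl (mul_inv_eq_one.1 h)
  · exact Or.inr (mul_inv_eq_iff_eq_mul.1 h)

theorem toFreeProd_surjective : Function.Surjective toFreeProd := by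
  rw [← MonoidHom.range_eq_top, eq_top_iff, ← closure_gens, Subgroup.closure_le]
  rintro _ (rfl | rfl)
  · exact ⟨S, toFreeProd_S⟩
  · exact ⟨U, toFreeProd_U⟩

/-- A function on the edges of the tree of the free product is a coboundary. -/
theorem exists_primitive_freeProd {M : Type} [AddCommGroup M] (φ : FreeProd → M) :
    ∃ a : FreeProd → M, (∀ x, a (sGen * x) = a x) ∧
      ∀ x, a (uGen * x) - φ (uGen * x) = a x - φ x := by
  have hs : sGen * sGen = 1 := by
    rw [sGen, ← map_mul, ← map_one (CoprodI.of (M := Cyc) (i := false))]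
    congr 1
  have hu : uGen * (uGen * uGen) = 1 := by
    rw [uGen, ← map_mul, ← map_mul, ← map_one (CoprodI.of (M := Cyc) (i := true))]
    congr 1
  -- The free product is made to act on pairs (vertex position, value): s keeps the value and u adds
  -- the increment of φ. Round a 3-cycle the increments telescope to zero, so the universal property
  -- applies, and the orbit of (1, 0) is the graph of the primitive.
  let σ : Equiv.Perm (FreeProd × M) :=
    { toFun := fun z => (sGen * z.1, z.2)
      invFun := fun z => (sGen * z.1, z.2)
      left_inv := fun z => by simp [← mul_assoc, hs]
      right_inv := fun z => by simp [← mul_assoc, hs] }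
  have hσ : σ ^ 2 = 1 := Equiv.ext fun z => by
    change (sGen * (sGen * z.1), z.2) = z
    rw [← mul_assoc, hs, one_mul]
  let τ : Equiv.Perm (FreeProd × M) :=
    { toFun := fun z => (uGen * z.1, z.2 + (φ (uGen * z.1) - φ z.1))
      invFun := fun z => (uGen⁻¹ * z.1, z.2 - (φ z.1 - φ (uGen⁻¹ * z.1)))
      left_inv := fun z => by simp
      right_inv := fun z => by simp }
  have hτ : τ ^ 3 = 1 := Equiv.ext fun z => by
    change (uGen * (uGen * (uGen * z.1)), z.2 + (φ (uGen * z.1) - φ z.1) +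
      (φ (uGen * (uGen * z.1)) - φ (uGen * z.1)) +
      (φ (uGen * (uGen * (uGen * z.1))) - φ (uGen * (uGen * z.1)))) = z
    have : uGen * (uGen * (uGen * z.1)) = z.1 := by
      rw [← mul_assoc, ← mul_assoc, mul_assoc uGen, hu, one_mul]
    rw [this]
    refine Prod.ext rfl ?_
    simp only
    abel
  let ρ := liftHom σ τ hσ hτ
  have hρs : ρ sGen = σ := liftHom_sGen _ _ _ _
  have hρu : ρ uGen = τ := liftHom_uGen _ _ _ _
  have hfst : ∀ x z, (ρ x z).1 = x * z.1 := fun x => by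
    let H : Subgroup FreeProd :=
      { carrier := {x | ∀ z, (ρ x z).1 = x * z.1}
        one_mem' := fun z => by simp
        mul_mem' := fun {x y} hx hy z => by
          rw [map_mul, Equiv.Perm.mul_apply, hx, hy, mul_assoc]
        inv_mem' := fun {x} hx z => by
          have := hx (ρ x⁻¹ z)
          rw [← Equiv.Perm.mul_apply, ← map_mul, mul_inv_cancel, map_one] at this
          rw [← Equiv.Perm.one_apply z, this, inv_mul_cancel_left]
          rfl }
    have : (⊤ : Subgroup FreeProd) ≤ H := by
      rw [← closure_gens, Subgroup.closure_le]
      rintro _ (rfl | rfl)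
      · exact fun z => by rw [hρs]; rfl
      · exact fun z => by rw [hρu]; rfl
    exact this (Subgroup.mem_top x)
  refine ⟨fun x => (ρ x (1, 0)).2, fun x => ?_, fun x => ?_⟩
  · change (ρ (sGen * x) (1, 0)).2 = _
    rw [map_mul, hρs]
    rfl
  · have : (ρ (uGen * x) (1, 0)).2 =
        (ρ x (1, 0)).2 + (φ (uGen * (ρ x (1, 0)).1) - φ (ρ x (1, 0)).1) := by
      rw [map_mul, hρu]
      rfl
    simp only [this, hfst, mul_one]
    abel

/-- Every even function on `SL₂(ℤ)` is the difference of a function that is left invariant under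
`S` and a function that is left invariant under `U`. -/
theorem exists_primitive {M : Type} [AddCommGroup M] (φ : SL(2, ℤ) → M)
    (hφ : ∀ x, φ (-1 * x) = φ x) :
    ∃ a : SL(2, ℤ) → M, (∀ x, a (S * x) = a x) ∧ ∀ x, a (U * x) - φ (U * x) = a x - φ x := by
  let r := Function.surjInv toFreeProd_surjective
  have hr : ∀ x, φ (r (toFreeProd x)) = φ x := fun x => by
    rcases toFreeProd_eq_iff (Function.surjInv_eq toFreeProd_surjective (toFreeProd x)) with h | h
    · exact congrArg φ h
    · exact (congrArg φ h).trans (hφ x)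
  obtain ⟨a, h1, h2⟩ := exists_primitive_freeProd fun y => φ (r y)
  refine ⟨fun x => a (toFreeProd x), fun x => ?_, fun x => ?_⟩
  · simp only [map_mul, toFreeProd_S, h1]
  · have := h2 (toFreeProd x)
    rwa [← toFreeProd_U, ← map_mul, hr, hr] at this

/-- Connectedness of the tree, the uniqueness that goes with `exists_primitive`: primitives are
determined up to a constant. -/
theorem eq_of_invariant {M : Type} (a : SL(2, ℤ) → M) (hS : ∀ x, a (S * x) = a x)
    (hU : ∀ x, a (U * x) = a x) (x y : SL(2, ℤ)) : a x = a y := by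
  let H : Subgroup SL(2, ℤ) :=
    { carrier := {g | ∀ x, a (g * x) = a x}
      one_mem' := fun x => by rw [one_mul]
      mul_mem' := fun {g h} hg hh x => by rw [mul_assoc, hg, hh]
      inv_mem' := fun {g} hg x => by rw [← hg, mul_inv_cancel_left] }
  have hH : (⊤ : Subgroup SL(2, ℤ)) ≤ H := by
    rw [← closure_S_U, Subgroup.closure_le]
    rintro _ (rfl | rfl)
    · exact hS
    · exact hU
  have := hH (Subgroup.mem_top (y * x⁻¹)) x
  rwa [inv_mul_cancel_right, eq_comm] at this

end ModularTree

end

/-! ### Groups acting freely on the tree lift crossed homomorphisms -/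

section

open groupCohomology

/-- As Γ is normal and meets F trivially, it acts freely on F\L. Once a representative y of the
double coset of x is chosen, the element γ in x = f y γ⁻¹ is therefore unique, and it is r(x). -/
theorem Subgroup.exists_equivariant_retraction {L : Type} [Group L] (Γ F : Subgroup L) [Γ.Normal]
    (hF : ∀ f ∈ F, f ∈ Γ → f = 1) :
    ∃ r : L → Γ, (∀ f ∈ F, ∀ x, r (f * x) = r x) ∧ ∀ (x : L) (γ : Γ), r (x * (γ : L)⁻¹) = γ * r x := by
  have hrep : ∀ x, ∃ f ∈ F, ∃ γ : Γ,
      x = f * (Quotient.out (DoubleCoset.mk F Γ x)) * (γ : L)⁻¹ := fun x => by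
    obtain ⟨f, γ, hf, hγ, h⟩ := DoubleCoset.mk_out_eq_mul F Γ x
    refine ⟨f⁻¹, inv_mem hf, ⟨γ, hγ⟩, ?_⟩
    change x = f⁻¹ * (DoubleCoset.mk F Γ x).out * γ⁻¹
    rw [h]
    group
  have huniq : ∀ (y f f' : L) (γ γ' : Γ), f ∈ F → f' ∈ F →
      f * y * (γ : L)⁻¹ = f' * y * (γ' : L)⁻¹ → γ = γ' := by
    intro y f f' γ γ' hf hf' h
    have h1 : f'⁻¹ * f = y * ((γ' : L)⁻¹ * γ) * y⁻¹ := by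
      rw [← mul_inv_eq_iff_eq_mul] at h
      have : f = f' * y * (γ' : L)⁻¹ * γ * y⁻¹ := by
        rw [← h]; group
      rw [this]; group
    have h2 : f'⁻¹ * f ∈ Γ := by
      rw [h1]
      exact ‹Γ.Normal›.conj_mem _ (Γ.mul_mem (Γ.inv_mem γ'.2) γ.2) y
    have h3 := hF _ (F.mul_mem (F.inv_mem hf') hf) h2
    rw [h3, eq_comm, mul_inv_eq_one, mul_eq_left, inv_mul_eq_one] at h1
    exact Subtype.ext h1.symm
  choose f hf γ hγ using hrep
  have hmk : ∀ (g : L) (δ : Γ) (x : L), g ∈ F →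
      DoubleCoset.mk F Γ (g * x * (δ : L)⁻¹) = DoubleCoset.mk F Γ x := fun g δ x hg => by
    refine (DoubleCoset.eq F Γ _ _).2 ⟨g⁻¹, inv_mem hg, δ, δ.2, ?_⟩
    group
  refine ⟨γ, fun g hg x => ?_, fun x δ => ?_⟩
  · have h1 := hγ (g * x)
    have h2 := hmk g 1 x hg
    simp only [Subgroup.coe_one, inv_one, mul_one] at h2
    rw [h2] at h1
    refine huniq _ _ _ _ _ (hf _) (F.mul_mem hg (hf x)) (h1.symm.trans ?_)
    conv_lhs => rw [hγ x]
    group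
  · have h1 := hγ (x * (δ : L)⁻¹)
    have h2 := hmk 1 δ x (one_mem F)
    rw [one_mul] at h2
    rw [h2] at h1
    refine huniq _ _ _ _ _ (hf _) (hf x) (h1.symm.trans ?_)
    conv_lhs => rw [hγ x]
    simp [mul_assoc]

namespace ModularTree

open Subgroup

/-- `Γ` acts freely on the vertices and edges of the tree of `SL₂(ℤ)`. -/
structure ActsFreely (Γ : Subgroup SL(2, ℤ)) : Prop where
  normal : Γ.Normal
  eq_one_of_S : ∀ f ∈ zpowers S, f ∈ Γ → f = 1
  eq_one_of_U : ∀ f ∈ zpowers U, f ∈ Γ → f = 1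

theorem neg_one_mem_S : (-1 : SL(2, ℤ)) ∈ zpowers S := ⟨2, by rw [← S_sq]; rfl⟩

theorem neg_one_mem_U : (-1 : SL(2, ℤ)) ∈ zpowers U := ⟨3, by rw [← U_cube]; rfl⟩

/-- The functions c ∘ rS and c ∘ rU on the two kinds of vertices both change under γ by the rule v ↦
γv + c(γ), so their difference e on edges is equivariant. A free action lets e be lifted
equivariantly to M; a primitive of the lift transforms in turn by a crossed homomorphism, and that
one lifts c. -/
theorem ActsFreely.liftsCrossedHoms {Γ : Subgroup SL(2, ℤ)} (hΓ : ActsFreely Γ) (k : Type)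
    [CommRing k] : LiftsCrossedHoms k Γ := by
  have := hΓ.normal
  intro M N f hf c
  have hc := cocycle_mul c
  obtain ⟨rS, hSl, hSr⟩ := exists_equivariant_retraction Γ (zpowers S) hΓ.eq_one_of_S
  obtain ⟨rU, hUl, hUr⟩ := exists_equivariant_retraction Γ (zpowers U) hΓ.eq_one_of_U
  have hS1 : ∀ x, rS (S * x) = rS x := hSl S (mem_zpowers S)
  have hU1 : ∀ x, rU (U * x) = rU x := hUl U (mem_zpowers U)
  let e : SL(2, ℤ) → N := fun x => c (rS x) - c (rU x)
  have he : ∀ x (γ : Γ), e (x * (γ : SL(2, ℤ))⁻¹) = N.ρ γ (e x) := fun x γ => by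
    simp only [e, hSr, hUr, hc, map_sub]
    abel
  have heneg : ∀ x, e (-1 * x) = e x := fun x => by
    simp only [e, hSl _ neg_one_mem_S, hUl _ neg_one_mem_U]
  let l := Function.surjInv hf
  have hl : ∀ y, f.hom (l y) = y := Function.surjInv_eq hf
  -- The product x · rS(x) does not change when x is replaced by xγ⁻¹, so l picks one lift per
  -- Γ-orbit and rS(x) transports it back to x.
  let e' : SL(2, ℤ) → M := fun x => M.ρ (rS x) (l (e (x * rS x)))
  have he'neg : ∀ x, e' (-1 * x) = e' x := fun x => by
    simp only [e', hSl _ neg_one_mem_S, mul_assoc, heneg]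
  have he' : ∀ x (γ : Γ), e' (x * (γ : SL(2, ℤ))⁻¹) = M.ρ γ (e' x) := fun x γ => by
    simp only [e', hSr, map_mul, Module.End.mul_apply]
    simp [mul_assoc]
  have hfe' : ∀ x, f.hom (e' x) = e x := fun x => by
    have := he x (rS x)⁻¹
    simp only [InvMemClass.coe_inv, inv_inv] at this
    simp only [e', Rep.hom_comm_apply, hl, this]
    rw [← Module.End.mul_apply, ← map_mul, mul_inv_cancel, map_one, Module.End.one_apply]
  obtain ⟨a, haS, haU⟩ := exists_primitive e' he'neg
  -- normalise the primitive
  obtain ⟨m, hm⟩ := hf (f.hom (a 1) - c (rS 1))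
  have hfa : ∀ x, f.hom (a x - m) = c (rS x) := fun x => by
    have h := eq_of_invariant (fun x => f.hom (a x) - c (rS x))
      (fun x => by simp only [haS, hS1]) (fun x => by
        have h1 := congrArg f.hom (haU x)
        rw [map_sub, map_sub, hfe', hfe'] at h1
        simp only [e, hU1] at h1
        have h2 : ∀ p q r s t : N, p - (q - r) = s - (t - r) → p - q = s - t := by
          intro p q r s t h
          rw [sub_sub_eq_add_sub, sub_sub_eq_add_sub, add_sub_right_comm, add_sub_right_comm] at h
          exact add_right_cancel h
        exact h2 _ _ _ _ _ h1) x 1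
    rw [map_sub, hm, ← h]
    abel
  let d : Γ → M := fun γ => (a ((γ : SL(2, ℤ))⁻¹) - m) - M.ρ γ (a 1 - m)
  -- Since e' is equivariant, the defect of equivariance of a does not depend on x. Evaluating it at
  -- x = δ⁻¹ instead of 1 is what gives the cocycle identity.
  have hd : ∀ (γ : Γ) x, (a (x * (γ : SL(2, ℤ))⁻¹) - m) - M.ρ γ (a x - m) = d γ := fun γ x => by
    have h := eq_of_invariant
      (fun x => (a (x * (γ : SL(2, ℤ))⁻¹) - m) - M.ρ γ (a x - m))
      (fun x => by simp only [mul_assoc, haS]) (fun x => by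
        have h1 := haU (x * (γ : SL(2, ℤ))⁻¹)
        have h2 := congrArg (M.ρ γ) (haU x)
        rw [← mul_assoc, he', he'] at h1
        rw [map_sub, map_sub] at h2
        have h3 : ∀ A B E : M, A - m - (B - M.ρ γ m) = (A - E) - (B - E) - m + M.ρ γ m :=
          fun A B E => by abel
        simp only [map_sub]
        rw [h3 _ _ (M.ρ γ (e' (U * x))), h1, h2, ← h3]) x 1
    simpa [d] using h
  refine ⟨⟨d, ?_⟩, fun γ => ?_⟩
  · rw [mem_cocycles₁_iff]
    intro γ δ
    have h1 := hd γ ((δ : SL(2, ℤ))⁻¹)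
    have h2 : (d δ : M) = (a ((δ : SL(2, ℤ))⁻¹) - m) - M.ρ δ (a 1 - m) := rfl
    have h3 : (d (γ * δ) : M) =
        (a (((γ * δ : Γ) : SL(2, ℤ))⁻¹) - m) - M.ρ (γ * δ) (a 1 - m) := rfl
    rw [h3, h2, ← h1, coe_mul, mul_inv_rev, map_mul, Module.End.mul_apply]
    simp only [map_sub]
    abel
  · change f.hom ((a ((γ : SL(2, ℤ))⁻¹) - m) - M.ρ γ (a 1 - m)) = c γ
    rw [map_sub, Rep.hom_comm_apply, hfa, hfa]
    have := hSr 1 γ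
    rw [one_mul] at this
    rw [this, hc, add_sub_cancel_left]

end ModularTree

end

/-! ### The rank of Hom(Γ, ℤ) from the quotient graph -/

section

namespace ModularTree

open Subgroup

section Rank

variable {Q : Type} [Group Q] (π : SL(2, ℤ) →* Q)

/-- The functions on `SL₂(ℤ)` that come from functions on `Q` invariant under the image of `F`. -/
def invFun (F : Subgroup SL(2, ℤ)) : Submodule ℤ (SL(2, ℤ) → ℤ) :=
  LinearMap.range (LinearMap.funLeft ℤ ℤ fun x => (QuotientGroup.mk (π x)⁻¹ : Q ⧸ F.map π))

variable {π}

/-- These are the functions on F\SL₂(ℤ)/ker π, that is, on the cells of one type in the quotient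
graph. The inverse in `invFun` turns this set into left cosets, so that the rank is an index. -/
theorem mem_invFun_iff (hπ : Function.Surjective π) {F : Subgroup SL(2, ℤ)} {φ : SL(2, ℤ) → ℤ} :
    φ ∈ invFun π F ↔ (∀ f ∈ F, ∀ x, φ (f * x) = φ x) ∧ ∀ γ ∈ π.ker, ∀ x, φ (x * γ) = φ x := by
  constructor
  · rintro ⟨ψ, rfl⟩
    refine ⟨fun f hf x => congrArg ψ ?_, fun γ hγ x => congrArg ψ ?_⟩
    · rw [QuotientGroup.eq]
      refine ⟨f, hf, ?_⟩
      simp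
    · change (QuotientGroup.mk (π (x * γ))⁻¹ : Q ⧸ F.map π) = QuotientGroup.mk (π x)⁻¹
      rw [map_mul, MonoidHom.mem_ker.1 hγ, mul_one]
  · rintro ⟨h1, h2⟩
    have hq : Function.Surjective fun x => (QuotientGroup.mk (π x)⁻¹ : Q ⧸ F.map π) := fun t => by
      obtain ⟨q, rfl⟩ := QuotientGroup.mk_surjective t
      obtain ⟨x, hx⟩ := hπ q⁻¹
      exact ⟨x, by simp [hx]⟩
    refine ⟨fun t => φ (Function.surjInv hq t), funext fun x => ?_⟩
    change φ (Function.surjInv hq (QuotientGroup.mk (π x)⁻¹)) = φ x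
    have h := Function.surjInv_eq hq (QuotientGroup.mk (π x)⁻¹)
    set y := Function.surjInv hq (QuotientGroup.mk (π x)⁻¹)
    obtain ⟨f, hf, hfy⟩ := QuotientGroup.eq.1 h
    have hγ : y⁻¹ * f * x ∈ π.ker := by
      rw [MonoidHom.mem_ker, map_mul, map_mul, hfy, map_inv]
      group
    rw [← h1 f hf x, ← h2 _ hγ y]
    congr 1
    group

theorem finrank_invFun (hπ : Function.Surjective π) [Finite Q] (F : Subgroup SL(2, ℤ)) :
    Module.Finite ℤ (invFun π F) ∧ Module.Free ℤ (invFun π F) ∧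
      Module.finrank ℤ (invFun π F) = (F.map π).index := by
  have hq : Function.Surjective fun x => (QuotientGroup.mk (π x)⁻¹ : Q ⧸ F.map π) := fun t => by
    obtain ⟨q, rfl⟩ := QuotientGroup.mk_surjective t
    obtain ⟨x, hx⟩ := hπ q⁻¹
    exact ⟨x, by simp [hx]⟩
  have := Fintype.ofFinite (Q ⧸ F.map π)
  let e : (Q ⧸ F.map π → ℤ) ≃ₗ[ℤ] invFun π F :=
    LinearEquiv.ofInjective _ (LinearMap.funLeft_injective_of_surjective ℤ ℤ _ hq)
  refine ⟨Module.Finite.equiv e, Module.Free.of_equiv e, ?_⟩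
  rw [← e.finrank_eq, Module.finrank_pi, ← Nat.card_eq_fintype_card, Subgroup.index]

/-- Euler characteristic of the quotient graph: with Γ = ker π there is an exact sequence 0 → ℤ →
Hom(Γ, ℤ) ⊕ ℤ^(S-vertices) ⊕ ℤ^(U-vertices) → ℤ^(edges) → 0. -/
theorem finrank_hom (hfree : ActsFreely π.ker) (hπ : Function.Surjective π) [Finite Q] :
    Module.Finite ℤ (Additive π.ker →+ ℤ) ∧ Module.Free ℤ (Additive π.ker →+ ℤ) ∧
      Module.finrank ℤ (Additive π.ker →+ ℤ) + ((zpowers S).map π).index +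
        ((zpowers U).map π).index = ((zpowers (-1)).map π).index + 1 := by
  have := hfree.normal
  obtain ⟨rS, hSl, hSr⟩ := exists_equivariant_retraction π.ker (zpowers S) hfree.eq_one_of_S
  obtain ⟨rU, hUl, hUr⟩ := exists_equivariant_retraction π.ker (zpowers U) hfree.eq_one_of_U
  have hS1 : ∀ x, rS (S * x) = rS x := hSl S (mem_zpowers S)
  have hU1 : ∀ x, rU (U * x) = rU x := hUl U (mem_zpowers U)
  obtain ⟨fS, frS, hS⟩ := finrank_invFun hπ (zpowers S)
  obtain ⟨fU, frU, hU⟩ := finrank_invFun hπ (zpowers U)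
  obtain ⟨fZ, frZ, hZ⟩ := finrank_invFun hπ (zpowers (-1))
  let ev : (SL(2, ℤ) → π.ker) → (Additive π.ker →+ ℤ) →ₗ[ℤ] (SL(2, ℤ) → ℤ) := fun r =>
    { toFun := fun c x => c (Additive.ofMul (r x))
      map_add' := fun _ _ => rfl
      map_smul' := fun _ _ => rfl }
  have hev : ∀ (r : SL(2, ℤ) → π.ker) (c : Additive π.ker →+ ℤ) x,
    ev r c x = c (Additive.ofMul (r x)) := fun _ _ _ => rfl
  have hmul : ∀ (r : SL(2, ℤ) → π.ker), (∀ x (γ : π.ker), r (x * (γ : SL(2, ℤ))⁻¹) = γ * r x) →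
      ∀ (c : Additive π.ker →+ ℤ) (γ : π.ker) x,
        ev r c (x * (γ : SL(2, ℤ))⁻¹) = c (Additive.ofMul γ) + ev r c x := fun r hr c γ x => by
    rw [hev, hr, ofMul_mul, map_add, hev]
  have hinv : ∀ (φ : SL(2, ℤ) → ℤ), (∀ (γ : π.ker) x, φ (x * (γ : SL(2, ℤ))⁻¹) = φ x) →
      ∀ γ ∈ π.ker, ∀ x, φ (x * γ) = φ x := fun φ h γ hγ x => by
    have := h ⟨γ, hγ⟩⁻¹ x
    simpa using this
  have hinv' : ∀ {F : Subgroup SL(2, ℤ)} (φ : invFun π F) (γ : π.ker) x,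
      φ.1 (x * (γ : SL(2, ℤ))⁻¹) = φ.1 x := fun φ γ x =>
    ((mem_invFun_iff hπ).1 φ.2).2 _ (inv_mem γ.2) x
  -- The edge function of (c, α, β) is the difference of the vertex functions c ∘ rS + α and c ∘ rU
  -- + β. If it vanishes, these agree and are constant by connectedness, which forces c = 0.
  -- Surjectivity is the existence of primitives: c is then the translation behaviour of the
  -- primitive.
  let Φ₀ : ((Additive π.ker →+ ℤ) × invFun π (zpowers S) × invFun π (zpowers U)) →ₗ[ℤ]
      (SL(2, ℤ) → ℤ) :=
    (ev rS - ev rU).coprod ((invFun π (zpowers S)).subtype.coprod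
      (-(invFun π (zpowers U)).subtype))
  have hΦ₀ : ∀ c α β x, Φ₀ (c, α, β) x = (ev rS c x - ev rU c x) + (α.1 x - β.1 x) :=
    fun c α β x => by
      simp [Φ₀, sub_eq_add_neg]
  have hle : ∀ {F : Subgroup SL(2, ℤ)} (φ : invFun π F), -1 ∈ F → ∀ f ∈ zpowers (-1 : SL(2, ℤ)),
      ∀ x, φ.1 (f * x) = φ.1 x := fun φ hF f hf x =>
    ((mem_invFun_iff hπ).1 φ.2).1 f (zpowers_le.2 hF hf) x
  have hmem : ∀ t, Φ₀ t ∈ invFun π (zpowers (-1)) := by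
    rintro ⟨c, α, β⟩
    rw [mem_invFun_iff hπ]
    refine ⟨fun f hf x => ?_, hinv _ fun γ x => ?_⟩
    · rw [hΦ₀, hΦ₀, hle α neg_one_mem_S f hf, hle β neg_one_mem_U f hf, hev, hev, hev, hev,
        hSl f (zpowers_le.2 neg_one_mem_S hf), hUl f (zpowers_le.2 neg_one_mem_U hf)]
    · rw [hΦ₀, hΦ₀, hinv', hinv', hmul rS hSr, hmul rU hUr]
      ring
  let Φ := Φ₀.codRestrict _ hmem
  have hker : ∀ c α β, Φ₀ (c, α, β) = 0 → c = 0 ∧ ∃ z : ℤ, ∀ x, α.1 x = z ∧ β.1 x = z := by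
    intro c α β h
    have h' : ∀ x, ev rS c x + α.1 x = ev rU c x + β.1 x := fun x => by
      have := hΦ₀ c α β x
      rw [h, Pi.zero_apply] at this
      linarith
    have hconst := eq_of_invariant (fun x => ev rS c x + α.1 x)
      (fun x => by
        simp only [hev, hS1, ((mem_invFun_iff hπ).1 α.2).1 S (mem_zpowers S)])
      (fun x => by
        simp only [h']
        simp only [hev, hU1, ((mem_invFun_iff hπ).1 β.2).1 U (mem_zpowers U)])
    have hc : c = 0 := by
      ext γ
      have := hconst (1 * (γ : SL(2, ℤ))⁻¹) 1
      simp only [hmul rS hSr, hinv'] at this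
      simpa using this
    subst hc
    refine ⟨rfl, α.1 1, fun x => ?_⟩
    have h1 := hconst x 1
    have h2 := h' x
    simp only [hev, AddMonoidHom.zero_apply, zero_add] at h1 h2
    exact ⟨h1, h2 ▸ h1⟩
  have hsurj : LinearMap.range Φ = ⊤ := by
    rw [LinearMap.range_eq_top]
    rintro ⟨φ, hφ⟩
    obtain ⟨hφ1, hφ2⟩ := (mem_invFun_iff hπ).1 hφ
    obtain ⟨a, haS, haU⟩ := exists_primitive φ (hφ1 _ (mem_zpowers _))
    have hφ3 : ∀ (γ : π.ker) x, φ (x * (γ : SL(2, ℤ))⁻¹) = φ x := fun γ x =>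
      hφ2 _ (inv_mem γ.2) x
    have hac : ∀ (γ : π.ker) x, a (x * (γ : SL(2, ℤ))⁻¹) - a x = a (γ : SL(2, ℤ))⁻¹ - a 1 :=
      fun γ x => by
        have := eq_of_invariant (fun x => a (x * (γ : SL(2, ℤ))⁻¹) - a x)
          (fun x => by simp only [mul_assoc, haS]) (fun x => by
            have h1 := haU (x * (γ : SL(2, ℤ))⁻¹)
            have h2 := haU x
            rw [← mul_assoc, hφ3, hφ3] at h1
            linarith) x 1
        simpa using this
    let c : Additive π.ker →+ ℤ :=
      { toFun := fun γ => a ((γ.toMul : π.ker) : SL(2, ℤ))⁻¹ - a 1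
        map_zero' := by simp
        map_add' := fun γ δ => by
          have := hac γ.toMul ((δ.toMul : π.ker) : SL(2, ℤ))⁻¹
          rw [toMul_add, coe_mul, mul_inv_rev]
          linarith }
    have hc : ∀ γ : π.ker, c (Additive.ofMul γ) = a (γ : SL(2, ℤ))⁻¹ - a 1 := fun _ => rfl
    let α : invFun π (zpowers S) := ⟨fun x => a x - ev rS c x, by
      rw [mem_invFun_iff hπ]
      refine ⟨fun f hf x => ?_, hinv (fun x => a x - ev rS c x) fun γ x => ?_⟩
      · have haF : a (f * x) = a x := by
          obtain ⟨i, rfl⟩ := hf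
          induction i using Int.induction_on generalizing x with
          | zero => simp
          | succ i ih =>
            have := ih (S * x)
            rw [haS] at this
            rw [← this]
            simp only [zpow_add_one, mul_assoc]
          | pred i ih =>
            have := ih (S⁻¹ * x)
            rw [← haS (S⁻¹ * x), mul_inv_cancel_left] at this
            rw [← this]
            simp only [zpow_sub_one, mul_assoc]
        rw [haF, hev, hev, hSl f hf]
      · rw [hmul rS hSr, hc, ← hac γ x]
        ring⟩
    let β : invFun π (zpowers U) := ⟨fun x => a x - φ x - ev rU c x, by
      rw [mem_invFun_iff hπ]
      refine ⟨fun f hf x => ?_, hinv (fun x => a x - φ x - ev rU c x) fun γ x => ?_⟩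
      · have haF : a (f * x) - φ (f * x) = a x - φ x := by
          obtain ⟨i, rfl⟩ := hf
          induction i using Int.induction_on generalizing x with
          | zero => simp
          | succ i ih =>
            have := ih (U * x)
            rw [haU] at this
            rw [← this]
            simp only [zpow_add_one, mul_assoc]
          | pred i ih =>
            have := ih (U⁻¹ * x)
            rw [← haU (U⁻¹ * x), mul_inv_cancel_left] at this
            rw [← this]
            simp only [zpow_sub_one, mul_assoc]
        rw [haF, hev, hev, hUl f hf]
      · rw [hmul rU hUr, hc, ← hac γ x, hφ3]
        ring⟩
    refine ⟨(c, α, β), Subtype.ext (funext fun x => ?_)⟩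
    change Φ₀ (c, α, β) x = φ x
    rw [hΦ₀]
    simp only [α, β]
    ring
  -- This embeds Hom(Γ, ℤ) in a free module of finite rank over ℤ, hence it is finite and free
  -- itself.
  have hηinj : Function.Injective (Φ ∘ₗ LinearMap.inl ℤ _ _) := by
    rw [injective_iff_map_eq_zero]
    intro c hc
    exact (hker c 0 0 (congrArg Subtype.val hc)).1
  have hfin : Module.Finite ℤ (Additive π.ker →+ ℤ) := Module.Finite.of_injective _ hηinj
  have htf : Module.Free ℤ (Additive π.ker →+ ℤ) := by
    have : Module.Free ℤ (LinearMap.range (Φ ∘ₗ LinearMap.inl ℤ (Additive π.ker →+ ℤ)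
      (invFun π (zpowers S) × invFun π (zpowers U)))) := inferInstance
    exact Module.Free.of_equiv (LinearEquiv.ofInjective _ hηinj).symm
  refine ⟨hfin, htf, ?_⟩
  have hconst : ∀ (F : Subgroup SL(2, ℤ)) (z : ℤ), (fun _ => z) ∈ invFun π F := fun F z =>
    (mem_invFun_iff hπ).2 ⟨fun _ _ _ => rfl, fun _ _ _ => rfl⟩
  let κ : ℤ →ₗ[ℤ] LinearMap.ker Φ :=
    { toFun := fun z => ⟨(0, ⟨fun _ => z, hconst _ z⟩, ⟨fun _ => z, hconst _ z⟩), by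
        refine Subtype.ext (funext fun x => ?_)
        change Φ₀ _ x = 0
        rw [hΦ₀]
        simp [hev]⟩
      map_add' := fun _ _ => by
        refine Subtype.ext (Prod.ext ?_ rfl)
        simp
      map_smul' := fun _ _ => by
        refine Subtype.ext (Prod.ext ?_ rfl)
        simp }
  have hκ : Function.Bijective κ := by
    constructor
    · intro z w h
      have h1 : (κ z).1.2.1.1 1 = (κ w).1.2.1.1 1 := by rw [h]
      exact h1
    · rintro ⟨⟨c, α, β⟩, h⟩
      obtain ⟨rfl, z, hz⟩ := hker c α β (congrArg Subtype.val h)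
      refine ⟨z, Subtype.ext (Prod.ext rfl (Prod.ext ?_ ?_))⟩
      · exact Subtype.ext (funext fun x => (hz x).1.symm)
      · exact Subtype.ext (funext fun x => (hz x).2.symm)
  have h1 := Submodule.finrank_quotient_add_finrank (LinearMap.ker Φ)
  rw [(Φ.quotKerEquivOfSurjective (LinearMap.range_eq_top.1 hsurj)).finrank_eq, ← (LinearEquiv.ofBijective κ hκ).finrank_eq, Module.finrank_self,
    Module.finrank_prod, Module.finrank_prod, hS, hU, hZ] at h1
  omega

end Rank

end ModularTree

end

/-! ### Reduction modulo p and the rank for Γ₂(p) -/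

section

namespace Matrix.SpecialLinearGroup

/-- Elementary matrices lift to ℤ. With nonzero lower left entry a matrix is a product upper · lower
· upper of such; otherwise adding the first row to the second reduces to that case. -/
theorem map_intCast_surjective (p : ℕ) [Fact p.Prime] :
    Function.Surjective (SpecialLinearGroup.map (n := Fin 2) (Int.castRingHom (ZMod p))) := by
  set π := SpecialLinearGroup.map (n := Fin 2) (Int.castRingHom (ZMod p))
  let upper : ZMod p → SL(2, ZMod p) := fun x => ⟨!![1, x; 0, 1], by simp⟩
  let lower : ZMod p → SL(2, ZMod p) := fun x => ⟨!![1, 0; x, 1], by simp⟩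
  have hu : ∀ x, upper x ∈ π.range := fun x => by
    obtain ⟨n, rfl⟩ := ZMod.intCast_surjective x
    refine ⟨⟨!![1, n; 0, 1], by simp⟩, ?_⟩
    ext i j
    change ((!![1, n; 0, 1] i j : ℤ) : ZMod p) = !![1, (n : ZMod p); 0, 1] i j
    fin_cases i <;> fin_cases j <;> simp
  have hl : ∀ x, lower x ∈ π.range := fun x => by
    obtain ⟨n, rfl⟩ := ZMod.intCast_surjective x
    refine ⟨⟨!![1, 0; n, 1], by simp⟩, ?_⟩
    ext i j
    change ((!![1, 0; n, 1] i j : ℤ) : ZMod p) = !![1, 0; (n : ZMod p), 1] i j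
    fin_cases i <;> fin_cases j <;> simp
  have key : ∀ g : SL(2, ZMod p), g.1 1 0 ≠ 0 → g ∈ π.range := fun g hg => by
    have hdet : g.1 0 0 * g.1 1 1 - g.1 0 1 * g.1 1 0 = 1 := by
      rw [← Matrix.det_fin_two]; exact g.2
    have : g = upper ((g.1 0 0 - 1) / g.1 1 0) * lower (g.1 1 0) *
        upper ((g.1 1 1 - 1) / g.1 1 0) := by
      apply Subtype.ext
      change g.1 = !![1, _; 0, 1] * !![1, 0; _, 1] * !![1, _; 0, 1]
      ext i j
      fin_cases i <;> fin_cases j <;> simp [Matrix.mul_apply, Fin.sum_univ_succ] <;> field_simp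
      · ring
      · linear_combination -hdet
      · ring
    rw [this]
    exact mul_mem (mul_mem (hu _) (hl _)) (hu _)
  intro g
  by_cases hg : g.1 1 0 = 0
  · have hdet : g.1 0 0 * g.1 1 1 - g.1 0 1 * g.1 1 0 = 1 := by
      rw [← Matrix.det_fin_two]; exact g.2
    have h : lower 1 * g ∈ π.range := by
      apply key
      change ((!![1, 0; 1, 1] : Matrix (Fin 2) (Fin 2) (ZMod p)) * g.1) 1 0 ≠ 0
      have h0 : g.1 0 0 ≠ 0 := by
        rintro h
        rw [hg, h] at hdet
        simp at hdet
      simpa [Matrix.mul_apply, Fin.sum_univ_succ, hg] using h0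
    have := mul_mem (inv_mem (hl 1)) h
    rwa [inv_mul_cancel_left] at this
  · exact key g hg

theorem card_fin_two (F : Type) [Field F] [Fintype F] :
    Nat.card SL(2, F) = (Nat.card F - 1) * Nat.card F * (Nat.card F + 1) := by
  have h1 := Subgroup.card_mul_index (GeneralLinearGroup.det (n := Fin 2) (R := F)).ker
  have h2 : (GeneralLinearGroup.det (n := Fin 2) (R := F)).range = ⊤ := by
    rw [MonoidHom.range_eq_top]
    intro u
    refine ⟨GeneralLinearGroup.mk'' !![(u : F), 0; 0, 1] (by simp), ?_⟩
    ext
    change Matrix.det !![(u : F), 0; 0, 1] = u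
    simp
  have h3 : Nat.card (GeneralLinearGroup.det (n := Fin 2) (R := F)).ker = Nat.card SL(2, F) := by
    refine (Nat.card_congr (Equiv.ofBijective (fun g : SL(2, F) =>
      (⟨toGL g, Units.ext g.2⟩ : (GeneralLinearGroup.det (n := Fin 2) (R := F)).ker))
      ⟨?_, ?_⟩)).symm
    · intro g h e
      exact toGL_injective (congrArg Subtype.val e)
    · rintro ⟨g, hg⟩
      exact ⟨⟨g.1, congrArg Units.val hg⟩, Subtype.ext (Units.ext rfl)⟩
  rw [Subgroup.index_ker, h2, h3, Subgroup.card_top, Nat.card_units, Matrix.card_GL_field,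
    Fin.prod_univ_two, ← Nat.card_eq_fintype_card] at h1
  -- The shift by 2 removes the truncated subtractions in the order of GL₂ and leaves a positive
  -- common factor q + 1 to cancel.
  obtain ⟨q, hq⟩ : ∃ q, Nat.card F = q + 2 :=
    ⟨Nat.card F - 2, by have := Finite.one_lt_card (α := F); omega⟩
  rw [hq] at h1 ⊢
  have e1 : (q + 2) ^ 2 - (q + 2) ^ ((0 : Fin 2) : ℕ) = (q + 1) * (q + 3) := by
    have : (q + 2) ^ 2 = (q + 1) * (q + 3) + 1 := by ring
    rw [this]
    simp
  have e2 : (q + 2) ^ 2 - (q + 2) ^ ((1 : Fin 2) : ℕ) = (q + 1) * (q + 2) := by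
    have : (q + 2) ^ 2 = (q + 1) * (q + 2) + (q + 2) := by ring
    rw [this]
    simp
  rw [e1, e2, show q + 2 - 1 = q + 1 from rfl] at h1
  rw [show q + 2 - 1 = q + 1 from rfl]
  apply Nat.eq_of_mul_eq_mul_right (show 0 < q + 1 by omega)
  rw [h1]
  ring

end Matrix.SpecialLinearGroup

namespace ModularTree

open Subgroup

section Congruence

variable {p : ℕ} [Fact p.Prime]

/-- Reduction modulo `p`. -/
abbrev reduction (p : ℕ) : SL(2, ℤ) →* SL(2, ZMod p) :=
  Matrix.SpecialLinearGroup.map (Int.castRingHom (ZMod p))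

theorem reduction_neg_one (hp : p ≠ 2) : reduction p (-1) ≠ 1 := fun h => by
  have : ((-1 : ℤ) : ZMod p) = 1 := by
    simpa using congrArg (fun g : SL(2, ZMod p) => g.1 0 0) h
  have h2 : Fact (2 < p) := ⟨lt_of_le_of_ne (Fact.out : p.Prime).two_le hp.symm⟩
  exact ZMod.neg_one_ne_one (n := p) (by simpa using this)

theorem orderOf_reduction_neg_one (hp : p ≠ 2) : orderOf (reduction p (-1)) = 2 :=
  orderOf_eq_prime (by rw [← map_pow]; simp) (reduction_neg_one hp)

theorem orderOf_reduction_S (hp : p ≠ 2) : orderOf (reduction p S) = 4 := by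
  refine orderOf_eq_prime_pow (p := 2) (n := 1) ?_ ?_
  · rw [← map_pow, pow_one, S_sq]
    exact reduction_neg_one hp
  · rw [← map_pow, pow_succ 2 1, pow_mul, pow_one, S_sq]
    simp

theorem orderOf_reduction_U (hp : p ≠ 2) : orderOf (reduction p U) = 6 := by
  refine orderOf_eq_of_pow_and_pow_div_prime (by norm_num) ?_ fun q hq hd => ?_
  · rw [← map_pow, show 6 = 3 * 2 from rfl, pow_mul, U_cube]
    simp
  · have hq' : q = 2 ∨ q = 3 := by
      have : q ∣ 2 * 3 := hd
      rcases (Nat.Prime.dvd_mul hq).1 this with h | h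
      · exact Or.inl ((Nat.prime_dvd_prime_iff_eq hq Nat.prime_two).1 h)
      · exact Or.inr ((Nat.prime_dvd_prime_iff_eq hq Nat.prime_three).1 h)
    rcases hq' with rfl | rfl
    · rw [← map_pow, show 6 / 2 = 3 from rfl, U_cube]
      exact reduction_neg_one hp
    · rw [← map_pow, show 6 / 3 = 2 from rfl]
      intro h
      have h0 : (((U ^ 2).1 0 0 : ℤ) : ZMod p) = 1 :=
        congrArg (fun g : SL(2, ZMod p) => g.1 0 0) h
      rw [show (U ^ 2).1 0 0 = 0 by decide, Int.cast_zero] at h0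
      exact zero_ne_one h0

/-- S and U keep their orders 4 and 6 modulo an odd p, so no nontrivial power of either lies in the
kernel of reduction. -/
theorem actsFreely_Gamma (hp : p ≠ 2) : ActsFreely (CongruenceSubgroup.Gamma p) where
  normal := CongruenceSubgroup.Gamma_normal p
  eq_one_of_S := by
    rintro _ ⟨i, rfl⟩ h
    have h4 : reduction p S ^ i = 1 := by rw [← map_zpow]; exact h
    rw [← orderOf_dvd_iff_zpow_eq_one, orderOf_reduction_S hp] at h4
    obtain ⟨j, rfl⟩ := h4
    have : S ^ ((4 : ℕ) : ℤ) = 1 := by decide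
    simp only [zpow_mul, this, one_zpow]
  eq_one_of_U := by
    rintro _ ⟨i, rfl⟩ h
    have h6 : reduction p U ^ i = 1 := by rw [← map_zpow]; exact h
    rw [← orderOf_dvd_iff_zpow_eq_one, orderOf_reduction_U hp] at h6
    obtain ⟨j, rfl⟩ := h6
    have : U ^ ((6 : ℕ) : ℤ) = 1 := by decide
    simp only [zpow_mul, this, one_zpow]

/-- The first cohomology of the principal congruence subgroup of level `p`. -/
theorem nonempty_hom_Gamma_equiv (hp : p ≠ 2) :
    Nonempty ((Additive (CongruenceSubgroup.Gamma p) →+ ℤ) ≃+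
      (Fin (1 + (p - 1) * p * (p + 1) / 12) → ℤ)) := by
  obtain ⟨h1, h2, h3⟩ := finrank_hom (π := reduction p) (actsFreely_Gamma hp)
    (Matrix.SpecialLinearGroup.map_intCast_surjective p)
  have hcard := Matrix.SpecialLinearGroup.card_fin_two (ZMod p)
  rw [Nat.card_zmod] at hcard
  have hi : ∀ x : SL(2, ℤ), orderOf (reduction p x) * ((zpowers x).map (reduction p)).index =
      (p - 1) * p * (p + 1) := fun x => by
    rw [MonoidHom.map_zpowers, ← Nat.card_zpowers, Subgroup.card_mul_index, hcard]
  have hS := hi S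
  have hU := hi U
  have hZ := hi (-1)
  rw [orderOf_reduction_S hp] at hS
  rw [orderOf_reduction_U hp] at hU
  rw [orderOf_reduction_neg_one hp] at hZ
  -- With n = (p - 1)p(p + 1) the indices are n/4, n/6 and n/2, and 1 + n/2 - n/4 - n/6 = 1 + n/12.
  -- The divisions are exact because 4 and 6 divide n.
  have h4 : Module.finrank ℤ (Additive (reduction p).ker →+ ℤ) =
      1 + (p - 1) * p * (p + 1) / 12 := by
    omega
  exact ⟨(Module.finBasisOfFinrankEq ℤ _ h4).equivFun.toAddEquiv⟩

end Congruence

end ModularTree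

end

/-! ### The splitting of `G₁ ∩ Γ(p)` -/

section

namespace Siegel

/-- The symmetric matrix with entries `x, y, z`. -/
def symMatrix (v : Fin 3 → ℤ) : Matrix (Fin 2) (Fin 2) ℤ := !![v 0, v 1; v 1, v 2]

theorem symMatrix_transpose (v : Fin 3 → ℤ) : (symMatrix v).transpose = symMatrix v := by
  ext i j
  fin_cases i <;> fin_cases j <;> rfl

theorem symMatrix_add (v w : Fin 3 → ℤ) : symMatrix (v + w) = symMatrix v + symMatrix w := by
  ext i j
  fin_cases i <;> fin_cases j <;> rfl

theorem symMatrix_zero : symMatrix 0 = 0 := by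
  ext i j
  fin_cases i <;> fin_cases j <;> rfl

theorem symMatrix_injective : Function.Injective symMatrix := fun v w h => by
  have h0 := congrFun (congrFun h 0) 0
  have h1 := congrFun (congrFun h 0) 1
  have h2 := congrFun (congrFun h 1) 1
  ext i
  fin_cases i
  exacts [h0, h1, h2]

/-- This identifies T with the congruence action on symmetric matrices, the form in which
conjugation by the Levi factor acts on V. -/
theorem symMatrix_sym2 (X : Matrix (Fin 2) (Fin 2) ℤ) (v : Fin 3 → ℤ) :
    symMatrix ((sym2Matrix X).mulVec v) = X * symMatrix v * X.transpose := by
  ext i j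
  fin_cases i <;> fin_cases j <;>
    simp [symMatrix, sym2Matrix, Matrix.mul_apply, Matrix.mulVec, dotProduct,
      Fin.sum_univ_succ] <;> ring

theorem Q_transpose : Q.transpose = Q := by decide

/-- As Q² = 1, the condition says that BQ is symmetric, whence the shape p · (symmetric) · Q of the
elements of V. -/
theorem unipotent_symplectic_iff (B : Matrix (Fin 2) (Fin 2) ℤ) :
    (block 1 B 0 1).transpose * J * block 1 B 0 1 = J ↔ Q * B = B.transpose * Q := by
  rw [block_transpose, J_eq_block, block_mul, block_mul]
  constructor
  · intro h
    have := (block_injective h).2.2.2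
    simp only [Matrix.transpose_one, one_mul, mul_one, mul_zero, add_zero, zero_add,
      mul_neg] at this
    exact (neg_add_eq_zero.1 (by rw [add_comm]; exact this)).symm
  · intro h
    congr 1 <;> simp [h]

theorem det_block (A B D : Matrix (Fin 2) (Fin 2) ℤ) : (block A B 0 D).det = A.det * D.det := by
  rw [block, Matrix.det_reindex_self, Matrix.det_fromBlocks_zero₂₁]

theorem mem_Gamma4_iff {p : ℕ} {g : Sp4} {A B C D : Matrix (Fin 2) (Fin 2) ℤ}
    (hg : mat g = block A B C D) :
    g ∈ Gamma4 p ↔ A.map (Int.castRingHom (ZMod p)) = 1 ∧ B.map (Int.castRingHom (ZMod p)) = 0 ∧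
      C.map (Int.castRingHom (ZMod p)) = 0 ∧ D.map (Int.castRingHom (ZMod p)) = 1 := by
  have h : g ∈ Gamma4 p ↔ (mat g).map (Int.castRingHom (ZMod p)) = 1 :=
    ⟨fun h => congrArg Subtype.val h, fun h => Subtype.ext h⟩
  have h1 : (1 : Matrix (Fin 4) (Fin 4) (ZMod p)) =
      Matrix.reindex finSumFinEquiv finSumFinEquiv
        (Matrix.fromBlocks (1 : Matrix (Fin 2) (Fin 2) (ZMod p)) 0 0
          (1 : Matrix (Fin 2) (Fin 2) (ZMod p))) := by
    rw [Matrix.fromBlocks_one]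
    simp
  rw [h, hg, block, Matrix.reindex_apply, ← Matrix.submatrix_map, Matrix.fromBlocks_map, h1,
    ← Matrix.reindex_apply, (Matrix.reindex finSumFinEquiv finSumFinEquiv).injective.eq_iff,
    Matrix.fromBlocks_inj]

/-- The upper right block `p (x, y; y, z) Q` of an element of `V`. -/
def upperBlock (p : ℕ) (v : Fin 3 → ℤ) : Matrix (Fin 2) (Fin 2) ℤ := (p : ℤ) • (symMatrix v * Q)

theorem Q_mul_upperBlock (p : ℕ) (v : Fin 3 → ℤ) :
    Q * upperBlock p v = (upperBlock p v).transpose * Q := by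
  rw [upperBlock, Matrix.transpose_smul, Matrix.transpose_mul, Q_transpose, symMatrix_transpose,
    Matrix.mul_smul, Matrix.smul_mul, Matrix.mul_assoc]

/-- The homomorphism from `ℤ³` to `Sp₄(ℤ)` with image `V`. -/
def unipotentHom (p : ℕ) : Z3 →* Sp4 where
  toFun v := ⟨⟨block 1 (upperBlock p v.toAdd) 0 1, by rw [det_block]; simp⟩,
    (unipotent_symplectic_iff _).2 (Q_mul_upperBlock p _)⟩
  map_one' := mat_injective (by
    change block 1 (upperBlock p 0) 0 1 = 1
    rw [upperBlock, symMatrix_zero, zero_mul, smul_zero, block_one])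
  map_mul' v w := mat_injective (by
    change block 1 (upperBlock p (v.toAdd + w.toAdd)) 0 1 =
      block 1 (upperBlock p v.toAdd) 0 1 * block 1 (upperBlock p w.toAdd) 0 1
    rw [block_mul, upperBlock, upperBlock, upperBlock, symMatrix_add, add_mul, smul_add]
    simp [add_comm])

theorem mat_unipotentHom (p : ℕ) (v : Z3) :
    mat (unipotentHom p v) = block 1 (upperBlock p v.toAdd) 0 1 := rfl

theorem unipotentHom_mem (p : ℕ) (v : Z3) : unipotentHom p v ∈ G1Gamma p := by
  refine ⟨⟨_, _, _, mat_unipotentHom p v⟩, (mem_Gamma4_iff (mat_unipotentHom p v)).2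
    ⟨Matrix.map_one _ (map_zero _) (map_one _), ?_, Matrix.map_zero _ (map_zero _),
      Matrix.map_one _ (map_zero _) (map_one _)⟩⟩
  ext i j
  change (((p : ℤ) * (symMatrix v.toAdd * Q) i j : ℤ) : ZMod p) = 0
  simp

/-- The homomorphism from `ℤ³` to `G₁ ∩ Γ(p)` with image `V`. -/
def unipotent (p : ℕ) : Z3 →* G1Gamma p :=
  (unipotentHom p).codRestrict (G1Gamma p) (unipotentHom_mem p)

theorem mat_unipotent (p : ℕ) (v : Z3) :
    mat (unipotent p v).1 = block 1 (upperBlock p v.toAdd) 0 1 := rfl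

theorem mat_levi (p : ℕ) (X : Gamma2 p) :
    mat (levi p X).1 = block X.1.1 0 0 (Q * (X.1⁻¹).1.transpose * Q) := rfl

theorem unipotent_conj (p : ℕ) (X : Gamma2 p) (v : Z3) :
    unipotent p (sym2Action p X v) = levi p X * unipotent p v * (levi p X)⁻¹ := by
  rw [eq_mul_inv_iff_mul_eq]
  apply Subtype.ext
  apply mat_injective
  rw [Subgroup.coe_mul, Subgroup.coe_mul, mat_mul, mat_mul, mat_unipotent, mat_levi, mat_unipotent,
    block_mul, block_mul]
  have h : upperBlock p (sym2Action p X v).toAdd * (Q * (X.1⁻¹).1.transpose * Q) =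
      X.1.1 * upperBlock p v.toAdd := by
    have h0 : X.1.1.transpose * (X.1⁻¹).1.transpose = 1 := by
      rw [← Matrix.transpose_mul, ← Matrix.SpecialLinearGroup.coe_mul, inv_mul_cancel,
        Matrix.SpecialLinearGroup.coe_one, Matrix.transpose_one]
    have h1 : symMatrix (sym2Action p X v).toAdd =
      X.1.1 * symMatrix v.toAdd * X.1.1.transpose := symMatrix_sym2 _ _
    rw [upperBlock, upperBlock, Matrix.smul_mul, Matrix.mul_smul, h1]
    congr 1
    calc X.1.1 * symMatrix v.toAdd * X.1.1.transpose * Q * (Q * (X.1⁻¹).1.transpose * Q)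
        = X.1.1 * symMatrix v.toAdd * (X.1.1.transpose * ((Q * Q) * (X.1⁻¹).1.transpose)) * Q := by
          simp only [Matrix.mul_assoc]
      _ = _ := by rw [Q_mul_Q, one_mul, h0, mul_one, Matrix.mul_assoc]
  rw [h]
  simp

/-- The homomorphism from the semidirect product to `G₁ ∩ Γ(p)`. -/
def semidirectHom (p : ℕ) : Z3 ⋊[sym2Action p] Gamma2 p →* G1Gamma p :=
  SemidirectProduct.lift (unipotent p) (levi p) fun X => MonoidHom.ext fun v => by
    simpa using unipotent_conj p X v

theorem semidirectHom_inl (p : ℕ) (v : Z3) :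
    semidirectHom p (SemidirectProduct.inl v) = unipotent p v := by
  simp [semidirectHom]

theorem semidirectHom_inr (p : ℕ) (X : Gamma2 p) :
    semidirectHom p (SemidirectProduct.inr X) = levi p X := by
  simp [semidirectHom]

theorem mem_V_iff {p : ℕ} (hp : p ≠ 0) (g : G1Gamma p) : g ∈ V p ↔ ∃ v, unipotent p v = g := by
  constructor
  · rintro ⟨B, hB⟩
    have h1 : Q * B = B.transpose * Q := by
      rw [← unipotent_symplectic_iff, ← hB]
      exact g.1.2
    obtain ⟨-, h2, -⟩ := (mem_Gamma4_iff hB).1 g.2.2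
    have hdvd : ∀ i j, (p : ℤ) ∣ B i j := fun i j => by
      rw [← ZMod.intCast_zmod_eq_zero_iff_dvd]
      exact congrFun (congrFun h2 i) j
    choose M hM using hdvd
    have h3 := congrFun (congrFun h1 0) 0
    simp [Q, Matrix.mul_apply, Fin.sum_univ_succ] at h3
    have h4 : M 1 1 = M 0 0 := by
      have : (p : ℤ) ≠ 0 := by exact_mod_cast hp
      apply mul_left_cancel₀ this
      rw [← hM, ← hM]
      have h4 := congrFun (congrFun h1 0) 1
      simpa [Q, Matrix.mul_apply, Fin.sum_univ_succ] using h4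
    -- Right multiplication by Q swaps the columns of M, so the symmetric matrix MQ has diagonal M 0
    -- 1, M 1 0 and off-diagonal entry M 0 0 = M 1 1.
    refine ⟨Multiplicative.ofAdd ![M 0 1, M 0 0, M 1 0], ?_⟩
    apply Subtype.ext
    apply mat_injective
    rw [hB, mat_unipotent]
    congr 1
    ext i j
    fin_cases i <;> fin_cases j <;>
      simp [upperBlock, symMatrix, Q, hM, h4]
  · rintro ⟨v, rfl⟩
    exact ⟨_, mat_unipotent p v⟩

theorem semidirectHom_bijective {p : ℕ} (hp : p.Prime) (hp2 : p ≠ 2) :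
    Function.Bijective (semidirectHom p) := by
  have hp0 : (p : ℤ) ≠ 0 := by exact_mod_cast hp.ne_zero
  constructor
  · rw [injective_iff_map_eq_one]
    rintro ⟨v, X⟩ h
    have h1 : mat (unipotent p v).1 * mat (levi p X).1 = 1 :=
      congrArg (fun g : G1Gamma p => mat g.1) h
    rw [mat_unipotent, mat_levi, block_mul, ← block_one] at h1
    obtain ⟨hA, hB, -, hD⟩ := block_injective h1
    simp only [one_mul, mul_zero, add_zero, zero_add] at hA hB hD
    rw [hD, mul_one, upperBlock] at hB
    have hv : symMatrix v.toAdd = symMatrix 0 := by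
      have h2 : symMatrix v.toAdd * Q = 0 := (smul_eq_zero.1 hB).resolve_left hp0
      calc symMatrix v.toAdd = symMatrix v.toAdd * (Q * Q) := by rw [Q_mul_Q, mul_one]
        _ = symMatrix 0 := by rw [← Matrix.mul_assoc, h2, zero_mul, symMatrix_zero]
    exact SemidirectProduct.ext (Multiplicative.toAdd.injective (symMatrix_injective hv))
      (Subtype.ext (Subtype.ext hA))
  · intro g
    obtain ⟨A, B, D, hg⟩ := g.2.1
    obtain ⟨hA, hB, -, hD⟩ := (mem_Gamma4_iff hg).1 g.2.2
    -- The determinant is a unit of ℤ and congruent to 1 modulo p; p ≠ 2 excludes -1.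
    have hdet : A.det = 1 := by
      have h1 : A.det * D.det = 1 := by
        rw [← det_block A B D, ← hg]
        exact g.1.1.2
      have h2 : ((A.det : ℤ) : ZMod p) = 1 := by
        have := (Int.castRingHom (ZMod p)).map_det A
        rw [RingHom.mapMatrix_apply, hA, Matrix.det_one] at this
        exact this
      rcases Int.isUnit_iff.1 (IsUnit.of_mul_eq_one _ h1) with h | h
      · exact h
      · have : Fact (2 < p) := ⟨lt_of_le_of_ne hp.two_le hp2.symm⟩
        rw [h] at h2
        exact absurd (by simpa using h2) (ZMod.neg_one_ne_one (n := p))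
    let X : Gamma2 p := ⟨⟨A, hdet⟩, Subtype.ext hA⟩
    have hsymp : (mat g.1).transpose * J * mat g.1 = J := g.1.2
    have hD' : D = Q * (X.1⁻¹).1.transpose * Q := by
      rw [hg, block_transpose, J_eq_block, block_mul, block_mul] at hsymp
      have h1 := (block_injective hsymp).2.1
      simp only [mul_zero, zero_mul, add_zero, zero_add, Matrix.transpose_zero, mul_neg,
        neg_mul, neg_inj] at h1
      have h0 : (X.1⁻¹).1.transpose * A.transpose = 1 := by
        have : A * (X.1⁻¹).1 = 1 := congrArg Subtype.val (mul_inv_cancel X.1)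
        rw [← Matrix.transpose_mul, this, Matrix.transpose_one]
      calc D = Q * (((X.1⁻¹).1.transpose * A.transpose) * (Q * D)) := by
            rw [h0, one_mul, ← Matrix.mul_assoc, Q_mul_Q, one_mul]
        _ = Q * ((X.1⁻¹).1.transpose * (A.transpose * Q * D)) := by simp only [Matrix.mul_assoc]
        _ = _ := by rw [h1, ← Matrix.mul_assoc]
    -- Dividing by the Levi element with the same upper left block leaves a unipotent element.
    have hV : g * (levi p X)⁻¹ ∈ V p := by
      refine ⟨B * (Q * A.transpose * Q), ?_⟩
      rw [← map_inv, Subgroup.coe_mul, mat_mul, hg, mat_levi, block_mul]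
      have h0 : A * (X.1⁻¹).1 = 1 := congrArg Subtype.val (mul_inv_cancel X.1)
      have h2 : ((X⁻¹).1⁻¹).1 = A := congrArg Subtype.val (inv_inv X.1)
      have h3 : ((X⁻¹).1).1 = (X.1⁻¹).1 := rfl
      rw [h2, h3, h0, hD']
      congr 1
      · simp
      · simp
      · simp
      · have h4 : (X.1⁻¹).1.transpose * A.transpose = 1 := by
          rw [← Matrix.transpose_mul, h0, Matrix.transpose_one]
        calc (0 : Matrix (Fin 2) (Fin 2) ℤ) * 0 +
              Q * (X.1⁻¹).1.transpose * Q * (Q * A.transpose * Q)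
            = Q * ((X.1⁻¹).1.transpose * ((Q * Q) * A.transpose)) * Q := by
              rw [zero_mul, zero_add]; simp only [Matrix.mul_assoc]
          _ = 1 := by rw [Q_mul_Q, one_mul, h4, mul_one, Q_mul_Q]
    obtain ⟨v, hv⟩ := (mem_V_iff hp.ne_zero _).1 hV
    refine ⟨⟨v, X⟩, ?_⟩
    change unipotent p v * levi p X = g
    rw [hv, inv_mul_cancel_right]

/-- The isomorphism `ℤ³ ⋊ Γ₂(p) ≅ G₁ ∩ Γ(p)`. -/
def semidirectEquiv {p : ℕ} (hp : p.Prime) (hp2 : p ≠ 2) :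
    Z3 ⋊[sym2Action p] Gamma2 p ≃* G1Gamma p :=
  MulEquiv.ofBijective (semidirectHom p) (semidirectHom_bijective hp hp2)

/-- The isomorphism `ℤ³ ≅ V`. -/
def unipotentEquiv {p : ℕ} (hp : p ≠ 0) : Z3 ≃* V p :=
  MulEquiv.ofBijective
    ((unipotent p).codRestrict (V p) fun v => (mem_V_iff hp _).2 ⟨v, rfl⟩)
    ⟨fun v w h => by
      have h1 := (block_injective (congrArg (fun g : V p => mat g.1.1) h)).2.1
      have hp0 : (p : ℤ) ≠ 0 := by exact_mod_cast hp
      have h2 : symMatrix v.toAdd * Q = symMatrix w.toAdd * Q := smul_right_injective _ hp0 h1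
      refine Multiplicative.toAdd.injective (symMatrix_injective ?_)
      calc symMatrix v.toAdd = symMatrix v.toAdd * (Q * Q) := by rw [Q_mul_Q, mul_one]
        _ = symMatrix w.toAdd * (Q * Q) := by rw [← Matrix.mul_assoc, h2, Matrix.mul_assoc]
        _ = symMatrix w.toAdd := by rw [Q_mul_Q, mul_one],
    fun g => by
      obtain ⟨v, hv⟩ := (mem_V_iff hp _).1 g.2
      exact ⟨v, Subtype.ext hv⟩⟩

theorem unipotentEquiv_equivariant {p : ℕ} (hp : p ≠ 0) (X : Gamma2 p) (v : Z3) :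
    unipotentEquiv hp (sym2Action p X v) = conjV p X (unipotentEquiv hp v) :=
  Subtype.ext (unipotent_conj p X v)

end Siegel

end

/-! ### The cohomology of ℤ³ as a module over Γ₂(p) -/

section

open CategoryTheory groupCohomology

namespace groupCohomology

variable {k G : Type} [CommRing k] [Group G]

/-- A functional that kills coboundaries descends to cochains modulo coboundaries, of which
cohomology is a subobject. -/
theorem exists_functional (A : Rep.{0} k G) (n : ℕ) (l : ((Fin (n + 1) → G) → A) →ₗ[k] k)
    (hl : ∀ g, l (inhomogeneousCochains.d A n g) = 0) :
    ∃ L : groupCohomology A (n + 1) →ₗ[k] k, ∀ f h, L (π A (n + 1) (cocyclesMk f h)) = l f := by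
  let κ : (inhomogeneousCochains A).X (n + 1) ⟶ ModuleCat.of k k := ModuleCat.ofHom l
  have hκ : (inhomogeneousCochains A).d n (n + 1) ≫ κ = 0 := by
    rw [inhomogeneousCochains.d_def]
    exact ModuleCat.hom_ext (LinearMap.ext hl)
  refine ⟨((inhomogeneousCochains A).homologyι (n + 1) ≫
    (inhomogeneousCochains A).descOpcycles κ n (by simp) hκ).hom, fun f h => ?_⟩
  have h1 : (inhomogeneousCochains A).homologyπ (n + 1) ≫
      (inhomogeneousCochains A).homologyι (n + 1) ≫
      (inhomogeneousCochains A).descOpcycles κ n (by simp) hκ =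
        (inhomogeneousCochains A).iCycles (n + 1) ≫ κ := by
    rw [HomologicalComplex.homology_π_ι_assoc, HomologicalComplex.p_descOpcycles]
  refine (ConcreteCategory.congr_hom h1 (cocyclesMk f h)).trans ?_
  change l (iCocycles A (n + 1) (cocyclesMk f h)) = l f
  rw [iCocycles_mk]

end groupCohomology

namespace Siegel

section Cochains

variable {N Γ : Type} [Group N] [Group Γ]

/-- The differential on inhomogeneous cochains with values in `ℤ`. -/
def dZ (n : ℕ) (f : (Fin n → N) → ℤ) : (Fin (n + 1) → N) → ℤ :=
  inhomogeneousCochains.d (Rep.trivial ℤ N ℤ) n f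

/-- The cohomology class of a cocycle. -/
def classOf {n : ℕ} (f : (Fin n → N) → ℤ) (h : dZ n f = 0) : HZ N n :=
  π (Rep.trivial ℤ N ℤ) n (cocyclesMk f h)

theorem dZ_apply (n : ℕ) (f : (Fin n → N) → ℤ) (x : Fin (n + 1) → N) :
    dZ n f x = f (fun i => x i.succ) +
      ∑ j : Fin (n + 1), (-1 : ℤ) ^ ((j : ℕ) + 1) • f (Fin.contractNth j (· * ·) x) := rfl

theorem dZ_zero (f : (Fin 0 → N) → ℤ) : dZ 0 f = 0 := by
  funext x
  rw [dZ_apply, Fin.sum_univ_one, Subsingleton.elim (Fin.contractNth _ _ _) fun i => x i.succ]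
  simp

theorem dZ_one (f : (Fin 1 → N) → ℤ) (x : Fin 2 → N) :
    dZ 1 f x = f ![x 1] - f ![x 0 * x 1] + f ![x 0] := by
  have h0 : (fun i : Fin 1 => x i.succ) = ![x 1] := by
    ext i; fin_cases i; rfl
  have h1 : Fin.contractNth (0 : Fin 2) (· * ·) x = ![x 0 * x 1] := by
    ext i; fin_cases i; rfl
  have h2 : Fin.contractNth (1 : Fin 2) (· * ·) x = ![x 0] := by
    ext i; fin_cases i; rfl
  rw [dZ_apply, Fin.sum_univ_two, h0, h1, h2]
  simp
  ring

theorem dZ_two (f : (Fin 2 → N) → ℤ) (x : Fin 3 → N) :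
    dZ 2 f x = f ![x 1, x 2] - f ![x 0 * x 1, x 2] + f ![x 0, x 1 * x 2] - f ![x 0, x 1] := by
  have h0 : (fun i : Fin 2 => x i.succ) = ![x 1, x 2] := by
    ext i; fin_cases i <;> rfl
  have h1 : Fin.contractNth (0 : Fin 3) (· * ·) x = ![x 0 * x 1, x 2] := by
    ext i; fin_cases i <;> rfl
  have h2 : Fin.contractNth (1 : Fin 3) (· * ·) x = ![x 0, x 1 * x 2] := by
    ext i; fin_cases i <;> rfl
  have h3 : Fin.contractNth (2 : Fin 3) (· * ·) x = ![x 0, x 1] := by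
    ext i; fin_cases i <;> rfl
  rw [dZ_apply, Fin.sum_univ_three, h0, h1, h2, h3]
  simp
  ring

theorem dZ_three (f : (Fin 3 → N) → ℤ) (x : Fin 4 → N) :
    dZ 3 f x = f ![x 1, x 2, x 3] - f ![x 0 * x 1, x 2, x 3] + f ![x 0, x 1 * x 2, x 3] -
      f ![x 0, x 1, x 2 * x 3] + f ![x 0, x 1, x 2] := by
  have h0 : (fun i : Fin 3 => x i.succ) = ![x 1, x 2, x 3] := by
    ext i; fin_cases i <;> rfl
  have h1 : Fin.contractNth (0 : Fin 4) (· * ·) x = ![x 0 * x 1, x 2, x 3] := by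
    ext i; fin_cases i <;> rfl
  have h2 : Fin.contractNth (1 : Fin 4) (· * ·) x = ![x 0, x 1 * x 2, x 3] := by
    ext i; fin_cases i <;> rfl
  have h3 : Fin.contractNth (2 : Fin 4) (· * ·) x = ![x 0, x 1, x 2 * x 3] := by
    ext i; fin_cases i <;> rfl
  have h4 : Fin.contractNth (3 : Fin 4) (· * ·) x = ![x 0, x 1, x 2] := by
    ext i; fin_cases i <;> rfl
  rw [dZ_apply, Fin.sum_univ_four, h0, h1, h2, h3, h4]
  simp
  ring

theorem exists_cohomologyAction_classOf (φ : Γ →* MulAut N) {n : ℕ} (g : Γ)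
    (f : (Fin n → N) → ℤ) (h : dZ n f = 0) :
    ∃ h', cohomologyAction φ n g (classOf f h) = classOf (fun x => f (φ g⁻¹ ∘ x)) h' :=
  map_π_cocyclesMk (A := Rep.trivial ℤ N ℤ) (B := Rep.trivial ℤ N ℤ) (φ g⁻¹).toMonoidHom
    (𝟙 (Rep.trivial ℤ N ℤ)) f h

/-- If `Hⁿ⁺¹(N, ℤ)` is free of rank `m` and `m` functionals on cochains are dual to `m` families of
cocycles, then these cocycles represent all classes, and the functionals detect them. -/
theorem detect_classes {n m : ℕ} (hM : Nonempty (HZ N (n + 1) ≃+ (Fin m → ℤ)))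
    (l : Fin m → ((Fin (n + 1) → N) → ℤ) →ₗ[ℤ] ℤ) (hl : ∀ i g, l i (dZ n g) = 0)
    (F : (Fin m → ℤ) → (Fin (n + 1) → N) → ℤ) (hF : ∀ c, dZ (n + 1) (F c) = 0)
    (hlF : ∀ c i, l i (F c) = c i) :
    (∀ x : HZ N (n + 1), ∃ c, x = classOf (F c) (hF c)) ∧
      ∀ f f' h h', classOf (n := n + 1) f h = classOf f' h' ↔ ∀ i, l i f = l i f' := by
  obtain ⟨e⟩ := hM
  choose L hL using fun i => exists_functional (Rep.trivial ℤ N ℤ) n (l i) (hl i)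
  have hL' : ∀ i f h, L i (classOf f h) = l i f := hL
  let Λ : HZ N (n + 1) →+ (Fin m → ℤ) :=
    { toFun := fun x i => L i x
      map_zero' := funext fun i => map_zero (L i)
      map_add' := fun x y => funext fun i => map_add (L i) x y }
  have hs : ∀ c, Λ (classOf (F c) (hF c)) = c := fun c => funext fun i => by
    rw [← hlF c i]
    exact hL' i _ _
  -- Since the rank is known to be m, the detecting map becomes a surjective endomorphism of ℤᵐ,
  -- hence injective. No direct proof that the functionals detect coboundaries is needed.
  have hinj : Function.Injective Λ := by
    have h := OrzechProperty.injective_of_surjective_endomorphism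
      ((Λ.comp e.symm.toAddMonoidHom).toIntLinearMap) fun c =>
        ⟨e (classOf (F c) (hF c)), by simp [hs]⟩
    intro x y hxy
    have := @h (e x) (e y) (by simpa using hxy)
    exact e.injective this
  refine ⟨fun x => ⟨Λ x, hinj (hs _).symm⟩, fun f f' h h' => ⟨fun hff i => ?_, fun hff => ?_⟩⟩
  · rw [← hL' i f h, ← hL' i f' h', hff]
  · refine hinj (funext fun i => ?_)
    change L i _ = L i _
    rw [hL', hL', hff]

theorem classOf_eq_zero {n : ℕ} {f : (Fin (n + 1) → N) → ℤ} (h : dZ (n + 1) f = 0)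
    (hf : f = 0) : classOf f h = 0 :=
  π_eq_zero_of_eq_d (Rep.trivial ℤ N ℤ) f h 0 ((map_zero _).trans hf.symm)

end Cochains

section SymmetricSquare

/-- The standard basis of `ℤ³`. -/
def basisZ3 (i : Fin 3) : Z3 := Multiplicative.ofAdd (Pi.single i 1)

/-- The one-cocycles on `ℤ³` given by linear forms. -/
def linearCocycle (c : Fin 3 → ℤ) (x : Fin 1 → Z3) : ℤ := ∑ i, c i * (x 0).toAdd i

/-- The two-cocycles on `ℤ³` given by bilinear forms. -/
def bilinearCocycle (c : Fin 3 → ℤ) (x : Fin 2 → Z3) : ℤ :=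
  c 0 * ((x 0).toAdd 0 * (x 1).toAdd 1) + c 1 * ((x 0).toAdd 0 * (x 1).toAdd 2) +
    c 2 * ((x 0).toAdd 1 * (x 1).toAdd 2)

/-- The three-cocycles on `ℤ³` given by the standard trilinear form. -/
def trilinearCocycle (c : Fin 1 → ℤ) (x : Fin 3 → Z3) : ℤ :=
  c 0 * ((x 0).toAdd 0 * (x 1).toAdd 1 * (x 2).toAdd 2)

theorem dZ_linearCocycle (c : Fin 3 → ℤ) : dZ 1 (linearCocycle c) = 0 := by
  funext x
  simp only [dZ_one, linearCocycle, Fin.sum_univ_three, Matrix.cons_val_zero, toAdd_mul,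
    Pi.add_apply, Pi.zero_apply]
  ring

theorem dZ_bilinearCocycle (c : Fin 3 → ℤ) : dZ 2 (bilinearCocycle c) = 0 := by
  funext x
  simp only [dZ_two, bilinearCocycle, Matrix.cons_val_zero, Matrix.cons_val_one, toAdd_mul,
    Pi.add_apply, Pi.zero_apply]
  ring

theorem dZ_trilinearCocycle (c : Fin 1 → ℤ) : dZ 3 (trilinearCocycle c) = 0 := by
  funext x
  simp only [dZ_three, trilinearCocycle, Matrix.cons_val_zero, Matrix.cons_val_one,
    Matrix.cons_val, toAdd_mul, Pi.add_apply, Pi.zero_apply]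
  ring

/-- Evaluation of cochains. -/
def cochainEval {n : ℕ} (x : Fin n → Z3) : ((Fin n → Z3) → ℤ) →ₗ[ℤ] ℤ := LinearMap.proj x

/-- The functionals that detect the first cohomology of `ℤ³`. -/
def evalOne (i : Fin 3) : ((Fin 1 → Z3) → ℤ) →ₗ[ℤ] ℤ := cochainEval ![basisZ3 i]

/-- The alternating evaluation of two-cochains. -/
def evalTwo (a b : Z3) : ((Fin 2 → Z3) → ℤ) →ₗ[ℤ] ℤ :=
  cochainEval ![a, b] - cochainEval ![b, a]

/-- The functionals that detect the second cohomology of `ℤ³`. -/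
def evalPairs : Fin 3 → ((Fin 2 → Z3) → ℤ) →ₗ[ℤ] ℤ :=
  ![evalTwo (basisZ3 0) (basisZ3 1), evalTwo (basisZ3 0) (basisZ3 2),
    evalTwo (basisZ3 1) (basisZ3 2)]

/-- The alternating evaluation of three-cochains. -/
def evalThree (a b c : Z3) : ((Fin 3 → Z3) → ℤ) →ₗ[ℤ] ℤ :=
  cochainEval ![a, b, c] - cochainEval ![a, c, b] + cochainEval ![b, c, a] -
    cochainEval ![b, a, c] + cochainEval ![c, a, b] - cochainEval ![c, b, a]

theorem evalTwo_apply (a b : Z3) (f : (Fin 2 → Z3) → ℤ) :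
    evalTwo a b f = f ![a, b] - f ![b, a] := rfl

theorem evalThree_apply (a b c : Z3) (f : (Fin 3 → Z3) → ℤ) :
    evalThree a b c f = f ![a, b, c] - f ![a, c, b] + f ![b, c, a] - f ![b, a, c] +
      f ![c, a, b] - f ![c, b, a] := rfl

theorem evalOne_dZ (i : Fin 3) (g : (Fin 0 → Z3) → ℤ) : evalOne i (dZ 0 g) = 0 := by
  rw [dZ_zero, map_zero]

theorem evalTwo_dZ (a b : Z3) (g : (Fin 1 → Z3) → ℤ) : evalTwo a b (dZ 1 g) = 0 := by
  simp only [evalTwo_apply, dZ_one, Matrix.cons_val_zero, Matrix.cons_val_one, mul_comm b a]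
  ring

theorem evalPairs_dZ (i : Fin 3) (g : (Fin 1 → Z3) → ℤ) : evalPairs i (dZ 1 g) = 0 := by
  fin_cases i <;> exact evalTwo_dZ _ _ g

/-- Alternating over all orders of a, b, c cancels the terms of a coboundary in pairs because ℤ³ is
commutative. -/
theorem evalThree_dZ (a b c : Z3) (g : (Fin 2 → Z3) → ℤ) : evalThree a b c (dZ 2 g) = 0 := by
  simp only [evalThree_apply, dZ_two, Matrix.cons_val_zero, Matrix.cons_val_one, Matrix.cons_val,
    mul_comm b a, mul_comm c a, mul_comm c b]
  ring

theorem basisZ3_apply (i j : Fin 3) : (basisZ3 i).toAdd j = if j = i then 1 else 0 := by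
  change (Pi.single i 1 : Fin 3 → ℤ) j = _
  rw [Pi.single_apply]

theorem linearCocycle_eval (c : Fin 3 → ℤ) (i : Fin 3) : evalOne i (linearCocycle c) = c i := by
  change ∑ j, c j * (basisZ3 i).toAdd j = c i
  simp [basisZ3_apply]

theorem bilinearCocycle_eval (c : Fin 3 → ℤ) (i : Fin 3) :
    evalPairs i (bilinearCocycle c) = c i := by
  fin_cases i <;> simp [evalPairs, evalTwo_apply, bilinearCocycle, basisZ3_apply]

theorem trilinearCocycle_eval (c : Fin 1 → ℤ) (i : Fin 1) :
    evalThree (basisZ3 0) (basisZ3 1) (basisZ3 2) (trilinearCocycle c) = c i := by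
  fin_cases i
  simp [evalThree_apply, trilinearCocycle, basisZ3_apply]

theorem detect_one : (∀ x : HZ Z3 1, ∃ c, x = classOf (linearCocycle c) (dZ_linearCocycle c)) ∧
    ∀ f f' h h', classOf (n := 1) f h = classOf f' h' ↔ ∀ i, evalOne i f = evalOne i f' :=
  detect_classes (nonempty_HZ_equiv 3 1) evalOne evalOne_dZ linearCocycle dZ_linearCocycle
    linearCocycle_eval

theorem detect_two :
    (∀ x : HZ Z3 2, ∃ c, x = classOf (bilinearCocycle c) (dZ_bilinearCocycle c)) ∧
    ∀ f f' h h', classOf (n := 2) f h = classOf f' h' ↔ ∀ i, evalPairs i f = evalPairs i f' :=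
  detect_classes (nonempty_HZ_equiv 3 2) evalPairs evalPairs_dZ bilinearCocycle
    dZ_bilinearCocycle bilinearCocycle_eval

theorem detect_three :
    (∀ x : HZ Z3 3, ∃ c, x = classOf (trilinearCocycle c) (dZ_trilinearCocycle c)) ∧
    ∀ f f' h h', classOf (n := 3) f h = classOf f' h' ↔ ∀ _ : Fin 1,
      evalThree (basisZ3 0) (basisZ3 1) (basisZ3 2) f =
        evalThree (basisZ3 0) (basisZ3 1) (basisZ3 2) f' :=
  detect_classes (nonempty_HZ_equiv 3 3)
    (fun _ => evalThree (basisZ3 0) (basisZ3 1) (basisZ3 2)) (fun _ => evalThree_dZ _ _ _)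
    trilinearCocycle dZ_trilinearCocycle trilinearCocycle_eval

theorem sym2Action_basisZ3 {p : ℕ} (X : Gamma2 p) (i j : Fin 3) :
    (sym2Action p X (basisZ3 i)).toAdd j = sym2Matrix X.1.1 j i := by
  change (sym2Matrix X.1.1).mulVec (Pi.single i 1) j = _
  rw [Matrix.mulVec_single_one]
  rfl

/-- The upper unipotent generator of `Γ₂(p)`. -/
def upperUnipotent (p : ℕ) : Gamma2 p := ⟨⟨!![1, p; 0, 1], by simp⟩,
  CongruenceSubgroup.Gamma_mem.2 (by simp)⟩

/-- The lower unipotent generator of `Γ₂(p)`. -/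
def lowerUnipotent (p : ℕ) : Gamma2 p := ⟨⟨!![1, 0; p, 1], by simp⟩,
  CongruenceSubgroup.Gamma_mem.2 (by simp)⟩

theorem sym2Matrix_upperUnipotent (p : ℕ) : sym2Matrix (upperUnipotent p).1.1 =
    !![1, 2 * (p : ℤ), (p : ℤ) ^ 2; 0, 1, p; 0, 0, 1] := by
  simp [sym2Matrix, upperUnipotent]

theorem sym2Matrix_lowerUnipotent (p : ℕ) : sym2Matrix (lowerUnipotent p).1.1 =
    !![1, 0, 0; (p : ℤ), 1, 0; (p : ℤ) ^ 2, 2 * (p : ℤ), 1] := by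
  simp [sym2Matrix, lowerUnipotent]

theorem subsingleton_invariants_one {p : ℕ} (hp : p ≠ 0) :
    Subsingleton (cohomologyRep (sym2Action p) 1).ρ.invariants := by
  refine subsingleton_of_forall_eq 0 ?_
  rintro ⟨x, hx⟩
  obtain ⟨c, rfl⟩ := detect_one.1 x
  -- Invariance is used for X⁻¹, which acts as the pullback along X.
  have key : ∀ (X : Gamma2 p) i, ∑ j, c j * sym2Matrix X.1.1 j i = c i := fun X i => by
    obtain ⟨h', e⟩ := exists_cohomologyAction_classOf (sym2Action p) X⁻¹ (linearCocycle c)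
      (dZ_linearCocycle c)
    have := (detect_one.2 _ _ _ _).1 (e.symm.trans (hx X⁻¹)) i
    rw [linearCocycle_eval, inv_inv] at this
    rw [← this]
    simp only [← sym2Action_basisZ3]
    rfl
  -- The three equations reduce to 2p·c₀ = 0, p²·c₀ + p·c₁ = 0 and 2p·c₂ = 0.
  have u1 := key (upperUnipotent p) 1
  have u2 := key (upperUnipotent p) 2
  have l1 := key (lowerUnipotent p) 1
  rw [sym2Matrix_upperUnipotent] at u1 u2
  rw [sym2Matrix_lowerUnipotent] at l1
  simp [Fin.sum_univ_three, hp] at u1 u2 l1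
  simp [u1, hp] at u2
  have hc : c = 0 := by
    funext i
    fin_cases i
    exacts [u1, u2, l1]
  refine Subtype.ext (classOf_eq_zero _ ?_)
  funext x
  simp [linearCocycle, hc]

theorem subsingleton_invariants_two {p : ℕ} (hp : p ≠ 0) :
    Subsingleton (cohomologyRep (sym2Action p) 2).ρ.invariants := by
  refine subsingleton_of_forall_eq 0 ?_
  rintro ⟨x, hx⟩
  obtain ⟨c, rfl⟩ := detect_two.1 x
  have key : ∀ (X : Gamma2 p) i,
      evalPairs i (fun x => bilinearCocycle c (sym2Action p X ∘ x)) = c i := fun X i => by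
    obtain ⟨h', e⟩ := exists_cohomologyAction_classOf (sym2Action p) X⁻¹ (bilinearCocycle c)
      (dZ_bilinearCocycle c)
    have := (detect_two.2 _ _ _ _).1 (e.symm.trans (hx X⁻¹)) i
    rwa [bilinearCocycle_eval, inv_inv] at this
  -- With 2 × 2 minors in place of entries, the equations are p·c₀ = 0, p²·c₀ + 2p·c₁ = 0 and p·c₂ =
  -- 0.
  have u1 := key (upperUnipotent p) 1
  have u2 := key (upperUnipotent p) 2
  have l1 := key (lowerUnipotent p) 1
  simp [evalPairs, evalTwo_apply, bilinearCocycle, sym2Action_basisZ3,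
    sym2Matrix_upperUnipotent, sym2Matrix_lowerUnipotent] at u1 u2 l1
  have c0 : c 0 = 0 := u1.resolve_right hp
  have c2 : c 2 = 0 := l1.resolve_right hp
  have c1 : c 1 = 0 := by simpa [c0, c2, hp] using u2
  refine Subtype.ext (classOf_eq_zero _ ?_)
  funext x
  simp [bilinearCocycle, c0, c1, c2]

/-- The top cohomology is spanned by the determinant form, on which a matrix acts by its
determinant, and det T(X) = 1. -/
theorem isTrivial_cohomologyRep_three (p : ℕ) : (cohomologyRep (sym2Action p) 3).IsTrivial := by
  refine ⟨fun X => LinearMap.ext fun x => ?_⟩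
  obtain ⟨c, rfl⟩ := detect_three.1 x
  obtain ⟨h', e⟩ := exists_cohomologyAction_classOf (sym2Action p) X (trilinearCocycle c)
    (dZ_trilinearCocycle c)
  refine e.trans ((detect_three.2 _ _ _ _).2 fun i => ?_)
  rw [trilinearCocycle_eval c 0]
  have hdet : (sym2Matrix (X⁻¹).1.1).det = 1 := (sym2 (X⁻¹).1).2
  rw [Matrix.det_fin_three] at hdet
  simp only [evalThree_apply, trilinearCocycle, Function.comp, Matrix.cons_val_zero,
    Matrix.cons_val_one, Matrix.cons_val, sym2Action_basisZ3]
  linear_combination c 0 * hdet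

theorem isTrivial_cohomologyRep_zero {N Γ : Type} [Group N] [Group Γ] (φ : Γ →* MulAut N) :
    (cohomologyRep φ 0).IsTrivial :=
  ⟨fun g => LinearMap.ext fun x => H0val_injective (Rep.trivial ℤ N ℤ)
    (H0val_map (B := Rep.trivial ℤ N ℤ) (C := Rep.trivial ℤ N ℤ) (φ g⁻¹).toMonoidHom (𝟙 _) x)⟩

theorem subsingleton_HZ_Z3 {n : ℕ} (hn : 4 ≤ n) : Subsingleton (HZ Z3 n) := by
  obtain ⟨e⟩ := nonempty_HZ_equiv 3 n
  rw [Nat.choose_eq_zero_of_lt hn] at e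
  exact e.toEquiv.subsingleton

end SymmetricSquare

end Siegel

end

/-! ### Transport to V and the table of cohomology groups -/

section

open CategoryTheory groupCohomology

/-- An additive isomorphism is linear over the integers. -/
def AddEquiv.toLinearEquivInt {M N : Type} [AddCommGroup M] [AddCommGroup N] [Module ℤ M]
    [Module ℤ N] (e : M ≃+ N) : M ≃ₗ[ℤ] N :=
  e.toLinearEquiv fun c x => by simpa using map_intCast_smul e ℤ ℤ c x

namespace Siegel

section Transport

variable {N N' Γ : Type} [Group N] [Group N'] [Group Γ]

/-- The linear isomorphism on integral cohomology induced by an isomorphism of groups. -/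
def pullbackLinearEquiv (e : N ≃* N') (n : ℕ) : HZ N' n ≃ₗ[ℤ] HZ N n :=
  LinearEquiv.ofLinearMap (pullback e.toMonoidHom n) (pullback e.symm.toMonoidHom n)
    (by
      rw [← pullback_comp, ← pullback_id]
      congr 1
      ext x
      simp)
    (by
      rw [← pullback_comp, ← pullback_id]
      congr 1
      ext x
      simp)

/-- Equivariant isomorphisms induce isomorphisms on `H¹` with coefficients in the cohomology. -/
def H1CohomologyRepEquiv (φ : Γ →* MulAut N) (ψ : Γ →* MulAut N') (e : N ≃* N')
    (he : ∀ g x, e (φ g x) = ψ g (e x)) (n : ℕ) :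
    groupCohomology (cohomologyRep ψ n) 1 ≃+ groupCohomology (cohomologyRep φ n) 1 :=
  (mapIso (A := cohomologyRep φ n) (B := cohomologyRep ψ n) (MulEquiv.refl Γ)
    (pullbackLinearEquiv e n) (fun g => by
      change pullback e.toMonoidHom n ∘ₗ pullback (ψ g⁻¹).toMonoidHom n =
        pullback (φ g⁻¹).toMonoidHom n ∘ₗ pullback e.toMonoidHom n
      rw [← pullback_comp, ← pullback_comp]
      congr 1
      ext x
      exact (he g⁻¹ x).symm) 1).toLinearEquiv.toAddEquiv

end Transport

theorem subsingleton_H1_of_subsingleton {Γ : Type} [Group Γ] (A : Rep.{0} ℤ Γ) [Subsingleton A] :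
    Subsingleton (groupCohomology A 1) := by
  refine subsingleton_of_forall_eq 0 fun x => ?_
  induction x using H1_induction_on with | h c =>
  rw [H1π_eq_zero_iff']
  exact ⟨0, fun g => Subsingleton.elim _ _⟩

/-- `H¹` of a free group of coefficients of rank one with trivial action. -/
theorem nonempty_H1_equiv {Γ : Type} [Group Γ] (A : Rep.{0} ℤ Γ) [A.IsTrivial] (e : A ≃+ ℤ) :
    Nonempty (groupCohomology A 1 ≃+ (Additive Γ →+ ℤ)) :=
  ⟨(H1TrivialEquiv A).trans
    { toFun := fun f => e.toAddMonoidHom.comp f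
      invFun := fun f => e.symm.toAddMonoidHom.comp f
      left_inv := fun f => by ext; simp
      right_inv := fun f => by ext; simp
      map_add' := fun f g => by ext; simp }⟩

theorem cohomology_G1Gamma {p : ℕ} (hp : p.Prime) (hp2 : p ≠ 2) :
    Nonempty (HZ (G1Gamma p) 0 ≃+ ℤ) ∧
    Nonempty (HZ (G1Gamma p) 1 ≃+ (Fin (1 + (p - 1) * p * (p + 1) / 12) → ℤ)) ∧
    Nonempty (HZ (G1Gamma p) 2 ≃+ groupCohomology (cohomologyRep (conjV p) 1) 1) ∧
    Nonempty (HZ (G1Gamma p) 3 ≃+ (ℤ × groupCohomology (cohomologyRep (conjV p) 2) 1)) ∧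
    Nonempty (HZ (G1Gamma p) 4 ≃+ (Fin (1 + (p - 1) * p * (p + 1) / 12) → ℤ)) ∧
    ∀ n : ℕ, 5 ≤ n → Subsingleton (HZ (G1Gamma p) n) := by
  have := Fact.mk hp
  have hp0 := hp.ne_zero
  have hses := hasShortExact_HZ (sym2Action p)
    ((ModularTree.actsFreely_Gamma hp2).liftsCrossedHoms ℤ)
  let e : ∀ n, HZ (G1Gamma p) n ≃+ HZ (Z3 ⋊[sym2Action p] Gamma2 p) n :=
    pullbackEquiv (semidirectEquiv hp hp2)
  let c : ∀ n, groupCohomology (cohomologyRep (conjV p) n) 1 ≃+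
      groupCohomology (cohomologyRep (sym2Action p) n) 1 :=
    H1CohomologyRepEquiv _ _ (unipotentEquiv hp0) (unipotentEquiv_equivariant hp0)
  obtain ⟨r⟩ := ModularTree.nonempty_hom_Gamma_equiv hp2
  have t0 := isTrivial_cohomologyRep_zero (sym2Action p)
  have t3 := isTrivial_cohomologyRep_three p
  have s1 := subsingleton_invariants_one hp0
  have s2 := subsingleton_invariants_two hp0
  obtain ⟨d⟩ : Nonempty (HZ Z3 3 ≃+ ℤ) := by
    obtain ⟨d⟩ := nonempty_HZ_equiv 3 3
    exact ⟨d.trans (LinearEquiv.funUnique (Fin 1) ℤ ℤ).toAddEquiv⟩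
  refine ⟨⟨HZZeroEquiv _⟩, ?_, ?_, ?_, ?_, fun n hn => ?_⟩
  · obtain ⟨a⟩ := (hses 0).nonempty_equiv_left
    obtain ⟨b⟩ := nonempty_H1_equiv (cohomologyRep (sym2Action p) 0) (HZZeroEquiv Z3)
    exact ⟨(e 1).trans (a.symm.trans (b.trans r))⟩
  · obtain ⟨a⟩ := (hses 1).nonempty_equiv_left
    exact ⟨(e 2).trans (a.symm.trans (c 1).symm)⟩
  -- Degree three is the only one with a nonzero right term, H³(ℤ³) = ℤ; it is free, so the sequence
  -- splits.
  · obtain ⟨a⟩ := ((hses 2).congr (c 2).symm (e 3).symm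
      ((invariantsTrivialEquiv _).trans d)).nonempty_equiv_prod
    exact ⟨a.trans AddEquiv.prodComm⟩
  · have h4 : Subsingleton (HZ Z3 4) := subsingleton_HZ_Z3 le_rfl
    have h4' : Subsingleton (cohomologyRep (sym2Action p) 4).ρ.invariants :=
      Subtype.val_injective.subsingleton
    obtain ⟨a⟩ := (hses 3).nonempty_equiv_left
    obtain ⟨b⟩ := nonempty_H1_equiv (cohomologyRep (sym2Action p) 3) d
    exact ⟨(e 4).trans (a.symm.trans (b.trans r))⟩
  · obtain ⟨m, rfl⟩ : ∃ m, n = m + 1 := ⟨n - 1, by omega⟩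
    -- Here m = n - 1 ≥ 4, so the coefficients of both outer terms vanish.
    have hm : Subsingleton (cohomologyRep (sym2Action p) m) := subsingleton_HZ_Z3 (by omega)
    have hm' : Subsingleton (HZ Z3 (m + 1)) := subsingleton_HZ_Z3 (by omega)
    have h1 := subsingleton_H1_of_subsingleton (cohomologyRep (sym2Action p) m)
    have h2 : Subsingleton (cohomologyRep (sym2Action p) (m + 1)).ρ.invariants :=
      Subtype.val_injective.subsingleton
    obtain ⟨a⟩ := (hses m).nonempty_equiv_left
    exact ((e (m + 1)).trans a.symm).toEquiv.subsingleton

end Siegel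

end

end

theorem theorem6p1 (p : ℕ) (hp : p.Prime) (hp2 : p ≠ 2) :
    -- the semidirect product decomposition `G₁ ∩ Γ(p) ≅ ℤ³ ⋊ Γ₂(p)`, with `ℤ³` mapping onto `V`
    (∃ e : (Siegel.Z3 ⋊[Siegel.sym2Action p] Siegel.Gamma2 p) ≃* Siegel.G1Gamma p,
      (∀ v : Fin 3 → ℤ,
        Siegel.mat (e (SemidirectProduct.inl (Multiplicative.ofAdd v))).1 =
          Siegel.block 1 ((p : ℤ) • (!![v 0, v 1; v 1, v 2] * Siegel.Q)) 0 1) ∧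
      (∀ X : Siegel.Gamma2 p, e (SemidirectProduct.inr X) = Siegel.levi p X) ∧
      (e.toMonoidHom.comp SemidirectProduct.inl).range = Siegel.V p) ∧
    -- the integral cohomology
    Nonempty (Siegel.HZ (Siegel.G1Gamma p) 0 ≃ₗ[ℤ] ℤ) ∧
    Nonempty (Siegel.HZ (Siegel.G1Gamma p) 1 ≃ₗ[ℤ]
      (Fin (1 + (p - 1) * p * (p + 1) / 12) → ℤ)) ∧
    Nonempty (Siegel.HZ (Siegel.G1Gamma p) 2 ≃ₗ[ℤ]
      groupCohomology (Siegel.cohomologyRep (Siegel.conjV p) 1) 1) ∧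
    Nonempty (Siegel.HZ (Siegel.G1Gamma p) 3 ≃ₗ[ℤ]
      (ℤ × groupCohomology (Siegel.cohomologyRep (Siegel.conjV p) 2) 1)) ∧
    Nonempty (Siegel.HZ (Siegel.G1Gamma p) 4 ≃ₗ[ℤ]
      (Fin (1 + (p - 1) * p * (p + 1) / 12) → ℤ)) ∧
    ∀ n : ℕ, 5 ≤ n → Subsingleton (Siegel.HZ (Siegel.G1Gamma p) n) := by
  have hinl : ∀ v, Siegel.semidirectEquiv hp hp2 (SemidirectProduct.inl v) = Siegel.unipotent p v :=
    fun v => Siegel.semidirectHom_inl p v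
  obtain ⟨⟨h0⟩, ⟨h1⟩, ⟨h2⟩, ⟨h3⟩, ⟨h4⟩, h5⟩ := Siegel.cohomology_G1Gamma hp hp2
  refine ⟨⟨Siegel.semidirectEquiv hp hp2, fun v => ?_, fun X => Siegel.semidirectHom_inr p X, ?_⟩,
    ⟨h0.toLinearEquivInt⟩, ⟨h1.toLinearEquivInt⟩, ⟨h2.toLinearEquivInt⟩, ⟨h3.toLinearEquivInt⟩,
    ⟨h4.toLinearEquivInt⟩, h5⟩
  · rw [hinl]
    rfl
  · ext g
    rw [Siegel.mem_V_iff hp.ne_zero]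
    exact ⟨fun ⟨v, hv⟩ => ⟨v, (hinl v).symm.trans hv⟩, fun ⟨v, hv⟩ => ⟨v, (hinl v).trans hv⟩⟩
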